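/- Let $m\le n$ and let $\mathbb{R}^{m\times n}$ carry the Frobenius inner product and norm. For $X\in\mathbb{R}^{m\times n}$ let $\sigma_1(X)\ge\dots\ge\sigma_m(X)\ge 0$ be its singular values, $\mathcal{I}(X)=\{i:\sigma_i(X)>0\}$ and $\mathcal{Z}(X)=\{i:\sigma_i(X)=0\}$. Let $p\in(0,1)$, $\lambda>0$, $\mu\in(0,1)$ and $\beta>L_f\ge 0$. Let $f:\mathbb{R}^{m\times n}\to\mathbb{R}$ be differentiable with $\|\nabla f(X)-\nabla f(Y)\|_F\le L_f\|X-Y\|_F$ for all $X,Y$, and suppose that $F(X)=f(X)+\lambda\sum_{i=1}^m\sigma_i(X)^p$ is level-bounded (all its sublevel sets are bounded). Let $\bar\alpha>0$ satisfy $\bar\alpha<\sqrt{\beta/(\beta+3L_f)}$ or, if $f$ is convex, merely $\bar\alpha<1$. Let $\{X^k\}$, $\{\epsilon^k\}$ be generated by the following algorithm (EIRNRI). Start with $X^{-1}=X^0\in\mathbb{R}^{m\times n}$ and $\epsilon^0_1\ge\dots\ge\epsilon^0_m>0$. For $k=0,1,2,\dots$ put $w_i^k=w(\sigma_i(X^k),\epsilon_i^k)$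 with $w(s,e)=p(s+e)^{p-1}$, choose $\alpha_k\in[0,\bar\alpha]$, put $Y^k=X^k+\alpha_k(X^k-X^{k-1})$, let $X^{k+1}$ be any global minimizer over $X\in\mathbb{R}^{m\times n}$ of $$f(Y^k)+\langle X,\nabla f(Y^k)\rangle+\tfrac{\beta}{2}\|X-Y^k\|_F^2+\tfrac{\beta}{2}\|X-X^k\|_F^2+\lambda\sum_{i=1}^m w_i^k\sigma_i(X),$$ and define $\epsilon^{k+1}$ as follows, with $r=|\mathcal{I}(X^k)|$, $r'=|\mathcal{I}(X^{k+1})|$, and the convention that a threshold $\tau_1$ or $\tau_3$ whose index is $0$ equals $+\infty$. In each case let $\tau_1=\sigma_{r'}(X^{k+1})+\epsilon^{k+1}_{r'}$ (computed after $\epsilon^{k+1}_{r'}$ has been assigned), $\tau_2=\epsilon^k_{r'+1}$, and $T(e)=e$ if $\tau_1\ge\tau_2$, $T(e)=\min(e,\mu\tau_1)$ otherwise. * If $\mathcal{I}(X^{k+1})\subsetneq\mathcal{I}(X^k)$: $\epsilon_i^{k+1}=\mu\epsilon_i^k$ for $i\in\mathcal{I}(X^{k+1})$; $\epsilon_i^{k+1}=T(\epsilon_i^k)$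 for $i\in\mathcal{I}(X^k)\setminus\mathcal{I}(X^{k+1})$; and $\epsilon_i^{k+1}=\min(\epsilon_i^k,\tau_3)$ for $i\in\mathcal{Z}(X^k)$, where $\tau_3=\epsilon_r^{k+1}$. * If $\mathcal{I}(X^k)\subsetneq\mathcal{I}(X^{k+1})$: $\epsilon_i^{k+1}=\mu\epsilon_i^k$ for $i\in\mathcal{I}(X^k)$; $\epsilon_i^{k+1}=\mu\min(\epsilon_i^k,\tau_3)$ for $i\in\mathcal{I}(X^{k+1})\setminus\mathcal{I}(X^k)$, where $\tau_3=\epsilon^k_r$; and $\epsilon_i^{k+1}=T(\epsilon_i^k)$ for $i\in\mathcal{Z}(X^{k+1})$. * If $\mathcal{I}(X^k)=\mathcal{I}(X^{k+1})$: $\epsilon_i^{k+1}=\mu\epsilon_i^k$ for $i\in\mathcal{I}(X^{k+1})$ and $\epsilon_i^{k+1}=T(\epsilon_i^k)$ for $i\in\mathcal{Z}(X^{k+1})$. Then there is a constant $C_1>0$ with $$\sigma_i\!\left(\frac{X^k+Y^k}{2}-\frac{1}{2\beta}\nabla f(Y^k)\right)\le C_1\qquad\text{for all } i \text{ and all } k\ge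 0,\tag{$*$}$$ and for every $C_1>0$ satisfying $(*)$ the following hold. 1. If $w(\sigma_i(X^{\hat k}),\epsilon_i^{\hat k})>2\beta C_1/\lambda$ for some index $i$ and some $\hat k\ge 0$, then $\sigma_i(X^k)=0$ for all $k>\hat k$. Moreover, there are $\hat k\in\mathbb{N}$ and index sets $\mathcal{I}^*,\mathcal{Z}^*$ such that: 2. $\mathcal{I}(X^k)=\mathcal{I}^*$ and $\mathcal{Z}(X^k)=\mathcal{Z}^*$ for all $k>\hat k$. 3. For all $k>\hat k$ and all $i\in\mathcal{I}(X^k)$, $$\sigma_i(X^k)>\left(\frac{\lambda p}{2\beta C_1}\right)^{\frac{1}{1-p}}-\epsilon_i^k>0,$$ and $\displaystyle\liminf_{k\to\infty}\sigma_i(X^k)>\left(\frac{\lambda p}{2\beta C_1}\right)^{\frac{1}{1-p}}$ for all $i\in\mathcal{I}^*$. -/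

import Mathlib

namespace EIRNRI

open scoped Gradient

/-- The space of real `m × n` matrices with the Frobenius inner product `⟨X, Y⟩ = ∑ i j, X i j * Y i j`
and the Frobenius norm. -/
abbrev RMat (m n : ℕ) : Type := EuclideanSpace ℝ (Fin m × Fin n)

/-- The linear map `ℝⁿ → ℝᵐ` given by the matrix `X`. -/
noncomputable def toLin {m n : ℕ} (X : RMat m n) :
    EuclideanSpace ℝ (Fin n) →ₗ[ℝ] EuclideanSpace ℝ (Fin m) :=
  Matrix.toEuclideanLin (Matrix.of fun i j => X (i, j))

/-- The singular value vector `σ(X) ∈ ℝᵐ` of an `m × n` matrix (`m ≤ n`), in non-increasing order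
and counted with multiplicity (`σ X 0` is the largest one). -/
noncomputable def σ {m n : ℕ} (X : RMat m n) (i : Fin m) : ℝ :=
  (toLin X).singularValues i

/-- `𝓘(X) = {i : σ_i(X) > 0}`. -/
noncomputable def posIdx {m n : ℕ} (X : RMat m n) : Finset (Fin m) :=
  Finset.univ.filter fun i => 0 < σ X i

/-- `𝓩(X) = {i : σ_i(X) = 0}`. -/
noncomputable def zeroIdx {m n : ℕ} (X : RMat m n) : Finset (Fin m) :=
  Finset.univ.filter fun i => σ X i = 0

/-- The objective `F(X) = f(X) + lam * ∑ i, σ_i(X)^p`. -/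
noncomputable def objective {m n : ℕ} (f : RMat m n → ℝ) (lam p : ℝ) (X : RMat m n) : ℝ :=
  f X + lam * ∑ i, σ X i ^ p

/-- All sublevel sets are bounded. -/
def LevelBounded {m n : ℕ} (F : RMat m n → ℝ) : Prop :=
  ∀ a : ℝ, Bornology.IsBounded {X | F X ≤ a}

/-- `f` is differentiable and its gradient is `L`-Lipschitz in the Frobenius norm. -/
def LSmooth {m n : ℕ} (L : ℝ) (f : RMat m n → ℝ) : Prop :=
  Differentiable ℝ f ∧ ∀ X Y, ‖∇ f X - ∇ f Y‖ ≤ L * ‖X - Y‖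

/-- The weight function `w(s, e) = p (s + e)^(p-1)`. -/
noncomputable def weight (p s e : ℝ) : ℝ := p * (s + e) ^ (p - 1)

/-- The surrogate `L(X; Xk, Yk, ε)` minimized at each iteration. -/
noncomputable def surrogate {m n : ℕ} (f : RMat m n → ℝ) (lam p β : ℝ) (Xk Yk : RMat m n)
    (ε : Fin m → ℝ) (X : RMat m n) : ℝ :=
  f Yk + inner ℝ X (∇ f Yk) + β / 2 * ‖X - Yk‖ ^ 2 + β / 2 * ‖X - Xk‖ ^ 2
    + lam * ∑ i, weight p (σ Xk i) (ε i) * σ X i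

/-- The extrapolated point `Y^k = X^k + α_k (X^k - X^(k-1))`. For `k = 0` the truncated
subtraction gives `X (0 - 1) = X 0`, which is the initialization `X^(-1) = X^0`. -/
noncomputable def extrap {m n : ℕ} (X : ℕ → RMat m n) (α : ℕ → ℝ) (k : ℕ) : RMat m n :=
  X k + α k • (X k - X (k - 1))

/-- The centre `(X^k + Y^k)/2 - ∇f(Y^k)/(2β)` of the proximal form of the subproblem. -/
noncomputable def proxCenter {m n : ℕ} (f : RMat m n → ℝ) (β : ℝ) (X : ℕ → RMat m n) (α : ℕ → ℝ)
    (k : ℕ) : RMat m n :=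
  (1 / 2 : ℝ) • (X k + extrap X α k) - (1 / (2 * β)) • ∇ f (extrap X α k)

/-- The entry of `v` with one-based number `r`; a threshold that refers to an entry which does
not exist (`r = 0`: the minimum over the empty set of indices; `r = m + 1`: never used) is `+∞`. -/
noncomputable def entry {m : ℕ} (v : Fin m → ℝ) (r : ℕ) : EReal :=
  if h : 0 < r ∧ r ≤ m then ((v ⟨r - 1, by omega⟩ : ℝ) : EReal) else ⊤

/-- `e` if `τ₁ ≥ τ₂`, and `min(e, μ τ₁)` otherwise (then `τ₁ < +∞`). -/
noncomputable def trim (μ : ℝ) (τ₁ τ₂ : EReal) (e : ℝ) : ℝ :=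
  if τ₂ ≤ τ₁ then e else min e (μ * τ₁.toReal)

/-- `min(e, τ)` for a threshold `τ ∈ (-∞, +∞]`. -/
noncomputable def cap (τ : EReal) (e : ℝ) : ℝ := (min (e : EReal) τ).toReal

/-- Update of the perturbation when `𝓘(X') ⊂ 𝓘(X)` strictly
(`X = X^k`, `X' = X^(k+1)`, `ε = ε^k`). -/
noncomputable def updateShrink {m n : ℕ} (μ : ℝ) (X X' : RMat m n) (ε : Fin m → ℝ) :
    Fin m → ℝ :=
  let ε₁ : Fin m → ℝ := fun i => if i ∈ posIdx X' then μ * ε i else ε i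
  let τ₁ := entry (fun i => σ X' i + ε₁ i) (posIdx X').card
  let τ₂ := entry ε ((posIdx X').card + 1)
  let ε₂ : Fin m → ℝ := fun i =>
    if i ∈ posIdx X \ posIdx X' then trim μ τ₁ τ₂ (ε i) else ε₁ i
  let τ₃ := entry ε₂ (posIdx X).card
  fun i => if i ∈ zeroIdx X then cap τ₃ (ε i) else ε₂ i

/-- Update of the perturbation when `𝓘(X) ⊂ 𝓘(X')` strictly. -/
noncomputable def updateGrow {m n : ℕ} (μ : ℝ) (X X' : RMat m n) (ε : Fin m → ℝ) :
    Fin m → ℝ :=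
  let ε₁ : Fin m → ℝ := fun i => if i ∈ posIdx X then μ * ε i else ε i
  let τ₃ := entry ε (posIdx X).card
  let ε₂ : Fin m → ℝ := fun i =>
    if i ∈ posIdx X' \ posIdx X then μ * cap τ₃ (ε i) else ε₁ i
  let τ₁ := entry (fun i => σ X' i + ε₂ i) (posIdx X').card
  let τ₂ := entry ε ((posIdx X').card + 1)
  fun i => if i ∈ zeroIdx X' then trim μ τ₁ τ₂ (ε i) else ε₂ i

/-- Update of the perturbation when `𝓘(X) = 𝓘(X')`. -/
noncomputable def updateSame {m n : ℕ} (μ : ℝ) (X' : RMat m n) (ε : Fin m → ℝ) :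
    Fin m → ℝ :=
  let ε₁ : Fin m → ℝ := fun i => if i ∈ posIdx X' then μ * ε i else ε i
  let τ₁ := entry (fun i => σ X' i + ε₁ i) (posIdx X').card
  let τ₂ := entry ε ((posIdx X').card + 1)
  fun i => if i ∈ zeroIdx X' then trim μ τ₁ τ₂ (ε i) else ε₁ i

/-- The adaptive update of the perturbation. Singular values are sorted, so the sets `𝓘(X)` and
`𝓘(X')` are nested and the last branch is the case `𝓘(X) = 𝓘(X')`. -/
noncomputable def updateEps {m n : ℕ} (μ : ℝ) (X X' : RMat m n) (ε : Fin m → ℝ) :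
    Fin m → ℝ :=
  if posIdx X' ⊂ posIdx X then updateShrink μ X X' ε
  else if posIdx X ⊂ posIdx X' then updateGrow μ X X' ε
  else updateSame μ X' ε

/-- The admissible bounds for the extrapolation parameters: `αbar ∈ (0, 1)` if `f` is convex, and
`αbar ∈ (0, √(β / (β + 3 L)))` in general. -/
def AdmissibleBound {m n : ℕ} (f : RMat m n → ℝ) (L β αbar : ℝ) : Prop :=
  0 < αbar ∧
    ((ConvexOn ℝ Set.univ f ∧ αbar < 1) ∨ αbar < Real.sqrt (β / (β + 3 * L)))

/-- `X`, `ε`, `α` are the iterates, the perturbations and the extrapolation parameters of an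
infinite run of the extrapolated iteratively reweighted nuclear norm algorithm with rank
identification. -/
structure IsRun {m n : ℕ} (f : RMat m n → ℝ) (lam p β μ αbar : ℝ)
    (X : ℕ → RMat m n) (ε : ℕ → Fin m → ℝ) (α : ℕ → ℝ) : Prop where
  eps_zero_pos : ∀ i, 0 < ε 0 i
  eps_zero_antitone : Antitone (ε 0)
  alpha_mem : ∀ k, α k ∈ Set.Icc 0 αbar
  iterate_mem_argmin : ∀ k,
    IsMinOn (surrogate f lam p β (X k) (extrap X α k) (ε k)) Set.univ (X (k + 1))
  eps_succ : ∀ k, ε (k + 1) = updateEps μ (X k) (X (k + 1)) (ε k)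

/-- `C₁` is a positive bound for all singular values of all the matrices
`(X^k + Y^k)/2 - ∇f(Y^k)/(2β)`. -/
def IsCenterBound {m n : ℕ} (f : RMat m n → ℝ) (β : ℝ) (X : ℕ → RMat m n) (α : ℕ → ℝ)
    (C₁ : ℝ) : Prop :=
  0 < C₁ ∧ ∀ k i, σ (proxCenter f β X α k) i ≤ C₁

end EIRNRI

/-!
The iterates of the extrapolated iteratively reweighted nuclear norm algorithm identify the rank
after finitely many steps. The proof rests on four facts.

*Shrinkage.* Up to a constant the surrogate is `β ‖X - C‖² + lam ∑ w_i σ_i(X)`, where `C` is the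
prox centre (`surrogate_eq`). If the weights are non-decreasing in `i` and all singular values of
`C` are at most `C₁`, a minimizer satisfies `σ_i(X) + lam w_i / (2β) ≤ C₁` whenever `σ_i(X) > 0`
(`σ_add_le_of_isMinOn`). This replaces the closed form of the singular value thresholding operator
and needs no trace inequality: it suffices to compare `X` with `X - s X v vᵀ` for a right singular
vector `v` and `s → 0`. The comparison matrix differs from `X` in a single singular value
(`LinearMap.exists_singularValues_damp`).

*Order of the perturbations.* The update keeps `σ_i(X^k) + ε_i^k` non-increasing in `i`, so that the
weights are indeed non-decreasing; it increases no `ε_i` and multiplies `ε_i` by at most `μ` where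
`σ_i(X^(k+1)) > 0` (`updateEps_spec`).

*Boundedness.* The potential `f(X^k) + lam ∑ (σ_i(X^k) + ε_i^k)^p + β/2 ‖X^k - X^(k-1)‖²` is
non-increasing (`IsRun.potential_succ_le`). As the objective is level-bounded, the iterates and the
prox centres are bounded, which gives a constant `C₁` (`IsRun.exists_isCenterBound`).

*Dichotomy.* By shrinkage, a weight above `2βC₁/lam` at index `i` forces `σ_i = 0` at the next
iterate; the weight stays above that value because `ε_i` does not increase, so `σ_i` vanishes from
then on (`IsRun.σ_eq_zero_of_lt_weight`). If on the other hand `σ_i(X^k) > 0` infinitely often, then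
`ε_i^k → 0`; a later zero of `σ_i` would have a weight above `2βC₁/lam`, so `σ_i` is eventually
positive (`IsRun.eventually_σ_pos`). Positivity at `k + 1` gives the lower bound for `σ_i(X^k)`
(`IsRun.lt_σ_add_eps`), and using the shrinkage inequality once more makes the bound for the limit
inferior strict (`IsRun.lt_liminf_σ`).
-/

/-! ### Singular values and orthonormal bases -/

section SingularValues

open Module

variable {E F : Type*} [NormedAddCommGroup E] [InnerProductSpace ℝ E] [FiniteDimensional ℝ E]
  [NormedAddCommGroup F] [InnerProductSpace ℝ F] [FiniteDimensional ℝ F]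

/-- A non-increasing list of eigenvalues of an orthonormal eigenbasis is `eigenvalues`: both are the
sorted roots of the characteristic polynomial. -/
theorem LinearMap.IsSymmetric.eigenvalues_eq_of_orthonormalBasis {S : E →ₗ[ℝ] E}
    (hS : S.IsSymmetric) {n : ℕ} (hn : finrank ℝ E = n) (b : OrthonormalBasis (Fin n) ℝ E)
    {d : Fin n → ℝ} (hd : Antitone d) (hb : ∀ i, S (b i) = d i • b i) :
    hS.eigenvalues hn = d := by
  have hmat : LinearMap.toMatrix b.toBasis b.toBasis S = Matrix.diagonal d := by
    ext i k
    rw [LinearMap.toMatrix_apply]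
    simp [hb, Matrix.diagonal_apply]
    grind
  have hroots : S.charpoly.roots = Multiset.map d Finset.univ.val := by
    rw [← LinearMap.charpoly_toMatrix S b.toBasis, hmat, Matrix.charpoly_diagonal,
      Polynomial.roots_prod _ _
        (Finset.prod_ne_zero_iff.2 fun i _ => Polynomial.X_sub_C_ne_zero _)]
    simp
  rw [← List.ofFn_inj, ← hS.sort_roots_charpoly_eq_eigenvalues hn, hroots]
  simp_rw [Fin.univ_val_map, Multiset.map_coe, List.map_ofFn, Function.comp_def, RCLike.re_to_real,
    Multiset.coe_sort]
  refine List.mergeSort_of_pairwise ?_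
  simp_rw [decide_eq_true_eq, ← List.sortedGE_iff_pairwise]
  exact hd.sortedGE_ofFn

namespace LinearMap

variable (T : E →ₗ[ℝ] F)

/-- The orthonormal basis of right singular vectors: their images are pairwise orthogonal, with
the singular values as norms. -/
theorem exists_orthonormalBasis_singularValues {n : ℕ} (hn : finrank ℝ E = n) :
    ∃ b : OrthonormalBasis (Fin n) ℝ E, ∀ i k,
      inner ℝ (T (b i)) (T (b k)) = if i = k then T.singularValues i ^ 2 else 0 := by
  refine ⟨T.isSymmetric_adjoint_comp_self.eigenvectorBasis hn, fun i k => ?_⟩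
  have h := T.isSymmetric_adjoint_comp_self.apply_eigenvectorBasis hn i
  rw [LinearMap.comp_apply] at h
  rw [← LinearMap.adjoint_inner_left, h, T.sq_singularValues_fin hn]
  simp [inner_smul_left, OrthonormalBasis.inner_eq_ite]

/-- A non-increasing sequence of norms of the pairwise orthogonal images of an orthonormal basis is
the sequence of singular values. -/
theorem singularValues_eq_of_orthonormalBasis {n : ℕ} (hn : finrank ℝ E = n)
    (b : OrthonormalBasis (Fin n) ℝ E) {d : Fin n → ℝ} (hd : Antitone d) (hd0 : ∀ i, 0 ≤ d i)
    (hb : ∀ i k, inner ℝ (T (b i)) (T (b k)) = if i = k then d i ^ 2 else 0) (i : Fin n) :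
    T.singularValues i = d i := by
  have h := T.isSymmetric_adjoint_comp_self.eigenvalues_eq_of_orthonormalBasis hn b
    (d := fun i => d i ^ 2) (fun i j hij => pow_le_pow_left₀ (hd0 j) (hd hij) 2) fun i => by
      refine InnerProductSpace.ext_inner_left_basis b.toBasis fun k => ?_
      simp [LinearMap.adjoint_inner_right, hb, inner_smul_right, OrthonormalBasis.inner_eq_ite]
      grind
  rw [T.singularValues_fin hn, h, Real.sqrt_sq (hd0 i)]

theorem norm_apply_le_singularValues_zero (x : E) : ‖T x‖ ≤ T.singularValues 0 * ‖x‖ := by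
  obtain ⟨b, hb⟩ := T.exists_orthonormalBasis_singularValues rfl
  refine le_of_sq_le_sq ?_ (mul_nonneg (T.singularValues_nonneg 0) (norm_nonneg x))
  have hx : T x = ∑ i, (b.repr x i) • T (b i) := by
    conv_lhs => rw [← b.sum_repr x]
    simp
  have h1 : ‖T x‖ ^ 2 = ∑ i : Fin (finrank ℝ E), (b.repr x i) ^ 2 * T.singularValues i ^ 2 := by
    rw [← real_inner_self_eq_norm_sq, hx, sum_inner]
    refine Finset.sum_congr rfl fun i _ => ?_
    rw [inner_sum]
    simp only [real_inner_smul_left, real_inner_smul_right, hb, mul_ite, mul_zero]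
    simp
    ring
  have h2 : ‖x‖ ^ 2 = ∑ i : Fin (finrank ℝ E), (b.repr x i) ^ 2 := by
    rw [← b.repr.norm_map x, EuclideanSpace.norm_sq_eq]
    simp
  rw [h1, mul_pow, h2, Finset.mul_sum]
  refine Finset.sum_le_sum fun i _ => ?_
  rw [mul_comm]
  exact mul_le_mul_of_nonneg_right
    (pow_le_pow_left₀ (T.singularValues_nonneg _) (T.singularValues_antitone (Nat.zero_le _)) 2)
    (sq_nonneg _)

/-- Damping `T` along its `l`-th right singular vector `v` scales the `l`-th singular value and
keeps the others, as long as the order of the singular values is not disturbed. -/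
theorem exists_singularValues_damp {l : ℕ} (hl : l < finrank ℝ E) :
    ∃ v : E, ‖v‖ = 1 ∧ ‖T v‖ = T.singularValues l ∧
      ∀ s : ℝ, 0 ≤ s → s ≤ 1 → T.singularValues (l + 1) ≤ (1 - s) * T.singularValues l →
        ∀ T' : E →ₗ[ℝ] F, (∀ x, T' x = T x - (s * inner ℝ v x) • T v) → ∀ j,
          T'.singularValues j =
            if j = l then (1 - s) * T.singularValues l else T.singularValues j := by
  obtain ⟨b, hb⟩ := T.exists_orthonormalBasis_singularValues rfl
  refine ⟨b ⟨l, hl⟩, by simp, ?_, fun s hs0 hs1 hs T' hT' j => ?_⟩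
  · have h := hb ⟨l, hl⟩ ⟨l, hl⟩
    rw [real_inner_self_eq_norm_sq, if_pos rfl] at h
    exact (sq_eq_sq₀ (norm_nonneg _) (T.singularValues_nonneg _)).1 h
  by_cases hj : j < finrank ℝ E
  swap
  · rw [T'.singularValues_of_finrank_le (not_lt.1 hj), if_neg (by omega),
      T.singularValues_of_finrank_le (not_lt.1 hj)]
  have hT'b : ∀ i : Fin (finrank ℝ E), T' (b i) = (if (i : ℕ) = l then 1 - s else 1) • T (b i) := by
    intro i
    rw [hT', OrthonormalBasis.inner_eq_ite]
    by_cases hi : (i : ℕ) = l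
    · have : (⟨l, hl⟩ : Fin _) = i := Fin.ext hi.symm
      simp [this, hi, sub_smul]
    · have : (⟨l, hl⟩ : Fin _) ≠ i := fun h => hi (by rw [← h])
      simp [this, hi]
  refine T'.singularValues_eq_of_orthonormalBasis rfl b
    (d := fun j => if (j : ℕ) = l then (1 - s) * T.singularValues l else T.singularValues j)
    ?_ ?_ ?_ ⟨j, hj⟩
  · intro i k hik
    have h0 := T.singularValues_nonneg l
    have hik' : (i : ℕ) ≤ k := hik
    have hT := T.singularValues_antitone hik'
    dsimp only
    split_ifs with h1 h2 h2
    · exact le_rfl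
    · subst h1
      nlinarith
    · exact (T.singularValues_antitone (show l + 1 ≤ k by omega)).trans hs
    · exact hT
  · intro i
    have h0 := T.singularValues_nonneg l
    split_ifs
    · exact mul_nonneg (by linarith) h0
    · exact T.singularValues_nonneg _
  · intro i k
    rw [hT'b, hT'b, real_inner_smul_left, real_inner_smul_right, hb]
    by_cases hik : i = k
    · subst hik
      by_cases hi : (i : ℕ) = l <;> simp [hi]
      ring
    · simp [hik]

/-- Last index of a block of equal positive singular values. -/
theorem exists_last_singularValues_eq {i : ℕ} (hi : 0 < T.singularValues i) :
    ∃ l, i ≤ l ∧ T.singularValues l = T.singularValues i ∧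
      T.singularValues (l + 1) < T.singularValues l := by
  have hex : ∃ j, T.singularValues j < T.singularValues i :=
    ⟨finrank ℝ E, by rwa [T.singularValues_of_finrank_le le_rfl]⟩
  classical
  have hspec := Nat.find_spec hex
  have hlt : i < Nat.find hex := by
    by_contra h
    exact absurd (T.singularValues_antitone (not_lt.1 h)) (not_le.2 hspec)
  obtain ⟨l, hl⟩ : ∃ l, Nat.find hex = l + 1 := ⟨Nat.find hex - 1, by omega⟩
  have hle : T.singularValues i ≤ T.singularValues l :=
    not_lt.1 (Nat.find_min hex (show l < Nat.find hex by omega))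
  have heq := le_antisymm (T.singularValues_antitone (show i ≤ l by omega)) hle
  exact ⟨l, by omega, heq, by rw [heq, ← hl]; exact hspec⟩

end LinearMap

end SingularValues

namespace EIRNRI

/-! ### Singular values of matrices -/

variable {m n : ℕ}

theorem toLin_apply (X : RMat m n) (x : EuclideanSpace ℝ (Fin n)) (i : Fin m) :
    toLin X x i = ∑ j, X (i, j) * x j := by
  simp [toLin, Matrix.toLpLin_apply, Matrix.mulVec, dotProduct]

theorem σ_nonneg (X : RMat m n) (i : Fin m) : 0 ≤ σ X i :=
  (toLin X).singularValues_nonneg i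

theorem σ_antitone (X : RMat m n) : Antitone (σ X) := fun _ _ h =>
  (toLin X).singularValues_antitone h

theorem norm_toLin_le (X : RMat m n) (x : EuclideanSpace ℝ (Fin n)) :
    ‖toLin X x‖ ≤ ‖X‖ * ‖x‖ := by
  refine le_of_sq_le_sq ?_ (by positivity)
  rw [mul_pow, EuclideanSpace.norm_sq_eq, EuclideanSpace.norm_sq_eq X, EuclideanSpace.norm_sq_eq x,
    Fintype.sum_prod_type, Finset.sum_mul]
  refine Finset.sum_le_sum fun i _ => ?_
  simp only [Real.norm_eq_abs, sq_abs]
  rw [toLin_apply]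
  exact Finset.sum_mul_sq_le_sq_mul_sq _ _ _

theorem σ_le_norm (hmn : m ≤ n) (X : RMat m n) (i : Fin m) : σ X i ≤ ‖X‖ := by
  obtain ⟨v, hv, hXv, -⟩ := (toLin X).exists_singularValues_damp
    (l := i) (by simpa using i.2.trans_le hmn)
  calc σ X i = ‖toLin X v‖ := hXv.symm
    _ ≤ ‖X‖ * ‖v‖ := norm_toLin_le X v
    _ = ‖X‖ := by rw [hv, mul_one]

theorem norm_toLin_le_of_σ_le {X : RMat m n} {c : ℝ} (h : ∀ i, σ X i ≤ c) (i : Fin m)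
    (x : EuclideanSpace ℝ (Fin n)) : ‖toLin X x‖ ≤ c * ‖x‖ :=
  ((toLin X).norm_apply_le_singularValues_zero x).trans
    (mul_le_mul_of_nonneg_right (h ⟨0, i.pos⟩) (norm_nonneg x))

/-- The matrix `X v vᵀ`. -/
noncomputable def compRankOne (X : RMat m n) (v : EuclideanSpace ℝ (Fin n)) : RMat m n :=
  WithLp.toLp 2 fun a => toLin X v a.1 * v a.2

theorem inner_compRankOne (X A : RMat m n) (v : EuclideanSpace ℝ (Fin n)) :
    inner ℝ (compRankOne X v) A = inner ℝ (toLin X v) (toLin A v) := by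
  simp only [PiLp.inner_apply, compRankOne, Fintype.sum_prod_type, toLin_apply A]
  refine Finset.sum_congr rfl fun i _ => ?_
  simp only [RCLike.inner_apply, conj_trivial, Finset.sum_mul]
  exact Finset.sum_congr rfl fun j _ => by ring

theorem norm_compRankOne_sq (X : RMat m n) (v : EuclideanSpace ℝ (Fin n)) :
    ‖compRankOne X v‖ ^ 2 = ‖toLin X v‖ ^ 2 * ‖v‖ ^ 2 := by
  simp only [EuclideanSpace.norm_sq_eq, compRankOne, Fintype.sum_prod_type, Finset.sum_mul_sum,
    norm_mul, mul_pow]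

theorem toLin_sub_compRankOne (X : RMat m n) (v x : EuclideanSpace ℝ (Fin n)) (s : ℝ) :
    toLin (X - s • compRankOne X v) x = toLin X x - (s * inner ℝ v x) • toLin X v := by
  ext i
  simp only [toLin_apply, PiLp.sub_apply, PiLp.smul_apply, smul_eq_mul, compRankOne,
    PiLp.inner_apply, RCLike.inner_apply, conj_trivial, sub_mul, Finset.sum_sub_distrib,
    Finset.mul_sum, Finset.sum_mul]
  congr 1
  rw [Finset.sum_comm]
  exact Finset.sum_congr rfl fun j _ => Finset.sum_congr rfl fun k _ => by ring

/-- Damping `X` along the last right singular vector `v` of the block of `i` in the ordered list of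
singular values lowers the singular value with that last index `l` and no other one. -/
theorem exists_σ_damp (X : RMat m n) {i : Fin m} (hi : 0 < σ X i) :
    ∃ (l : Fin m) (v : EuclideanSpace ℝ (Fin n)) (s₀ : ℝ), i ≤ l ∧ σ X l = σ X i ∧ ‖v‖ = 1 ∧
      ‖toLin X v‖ = σ X l ∧ 0 < s₀ ∧ ∀ s, 0 ≤ s → s ≤ s₀ → ∀ j,
        σ (X - s • compRankOne X v) j = if j = l then (1 - s) * σ X l else σ X j := by
  obtain ⟨l, hil, heq, hlt⟩ := (toLin X).exists_last_singularValues_eq hi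
  have hpos : 0 < (toLin X).singularValues l := by rw [heq]; exact hi
  have hlr := (toLin X).singularValues_pos_iff_lt_finrank_range.1 hpos
  have hlm : l < m := hlr.trans_le (by simpa using (toLin X).range.finrank_le)
  have hln : l < Module.finrank ℝ (EuclideanSpace ℝ (Fin n)) :=
    hlr.trans_le (toLin X).finrank_range_le
  obtain ⟨v, hv, hXv, hdamp⟩ := (toLin X).exists_singularValues_damp hln
  refine ⟨⟨l, hlm⟩, v,
    1 - (toLin X).singularValues (l + 1) / (toLin X).singularValues l, hil, heq, hv, hXv, ?_, ?_⟩
  · rw [sub_pos, div_lt_one hpos]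
    exact hlt
  · intro s hs hs0 j
    have hdiv : 0 ≤ (toLin X).singularValues (l + 1) / (toLin X).singularValues l :=
      div_nonneg ((toLin X).singularValues_nonneg _) hpos.le
    have h := hdamp s hs (by linarith) ((div_le_iff₀ hpos).1 (by linarith)) _
      (fun x => toLin_sub_compRankOne X v x s) j
    simpa [σ, Fin.ext_iff] using h

/-- Shrinkage of the singular values by the weighted nuclear norm. At a minimizer `X` of
`β ‖X - C‖² + lam ∑ w_j σ_j(X)` with non-decreasing weights, damping `X` along a right singular
vector that belongs to the last index `l` of the block of `i` lowers `σ_l` only, at the rate `w_l`;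
minimality bounds this gain by the growth of the quadratic term. -/
theorem σ_add_le_of_isMinOn {β lam : ℝ} (hβ : 0 < β) (hlam : 0 < lam) {C X : RMat m n}
    {w : Fin m → ℝ} (hw : Monotone w)
    (hmin : ∀ Z, β * ‖X - C‖ ^ 2 + lam * ∑ j, w j * σ X j
      ≤ β * ‖Z - C‖ ^ 2 + lam * ∑ j, w j * σ Z j)
    {c : ℝ} (hC : ∀ j, σ C j ≤ c) {i : Fin m} (hi : 0 < σ X i) :
    σ X i + lam * w i / (2 * β) ≤ c := by
  obtain ⟨l, v, s₀, hil, heq, hv, hXv, hs₀, hσ⟩ := exists_σ_damp X hi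
  rw [← heq] at hi ⊢
  have hsum : ∀ s, 0 ≤ s → s ≤ s₀ →
      ∑ j, w j * σ (X - s • compRankOne X v) j = ∑ j, w j * σ X j - s * (w l * σ X l) := by
    intro s h0 h1
    have : ∀ j, w j * σ (X - s • compRankOne X v) j
        = w j * σ X j - if j = l then s * (w l * σ X l) else 0 := by
      intro j
      rw [hσ s h0 h1 j]
      split_ifs with h
      · subst h; ring
      · ring
    simp only [this, Finset.sum_sub_distrib, Finset.sum_ite_eq', Finset.mem_univ, if_true]
  have hCv : inner ℝ (compRankOne X v) C ≤ σ X l * c := by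
    rw [inner_compRankOne]
    refine (real_inner_le_norm _ _).trans ?_
    rw [hXv]
    have := norm_toLin_le_of_σ_le hC l v
    rw [hv, mul_one] at this
    exact mul_le_mul_of_nonneg_left this hi.le
  have hXX : inner ℝ (compRankOne X v) X = σ X l ^ 2 := by
    rw [inner_compRankOne, real_inner_self_eq_norm_sq, hXv]
  have hnn : ‖compRankOne X v‖ ^ 2 = σ X l ^ 2 := by
    rw [norm_compRankOne_sq, hXv, hv, one_pow, mul_one]
  have hkey : ∀ s, 0 < s → s ≤ s₀ →
      2 * β * σ X l + lam * w l ≤ 2 * β * c + s * (β * σ X l) := by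
    intro s h0 h1
    have h := hmin (X - s • compRankOne X v)
    rw [hsum s h0.le h1, show X - s • compRankOne X v - C = (X - C) - s • compRankOne X v by abel,
      norm_sub_sq_real (X - C), inner_smul_right, norm_smul, mul_pow, hnn,
      real_inner_comm (compRankOne X v), inner_sub_right, hXX, Real.norm_eq_abs, sq_abs] at h
    -- `hmin` is linear in `s` up to the term `s² σ_l²`; divide it by `s σ_l`
    have h2 : 0 ≤ s * σ X l * (2 * β * c + s * (β * σ X l) - (2 * β * σ X l + lam * w l)) := by
      have : s * (2 * β) * inner ℝ (compRankOne X v) C ≤ s * (2 * β) * (σ X l * c) :=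
        mul_le_mul_of_nonneg_left hCv (by positivity)
      nlinarith
    have := nonneg_of_mul_nonneg_right h2 (by positivity)
    linarith
  have hlim : 2 * β * σ X l + lam * w l ≤ 2 * β * c := by
    -- let `s → 0` in `hkey`
    refine le_of_forall_pos_le_add fun δ hδ => ?_
    have hpos : 0 < β * σ X l := by positivity
    refine (hkey (min s₀ (δ / (β * σ X l))) (lt_min hs₀ (by positivity)) (min_le_left _ _)).trans ?_
    have := mul_le_mul_of_nonneg_right (min_le_right s₀ (δ / (β * σ X l))) hpos.le
    rw [div_mul_cancel₀ _ hpos.ne'] at this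
    linarith
  have hwil : lam * w i ≤ lam * w l := mul_le_mul_of_nonneg_left (hw hil) hlam.le
  rw [← le_sub_iff_add_le', div_le_iff₀ (by positivity)]
  linarith

end EIRNRI

namespace EIRNRI

variable {m n : ℕ}

/-! ### The update of the perturbation -/

/-- As singular values are sorted, `𝓘(X)` consists of the first `|𝓘(X)|` indices. -/
theorem mem_posIdx_iff_lt_card {X : RMat m n} {i : Fin m} :
    i ∈ posIdx X ↔ (i : ℕ) < (posIdx X).card := by
  have hset : posIdx X = Finset.univ.filter
      fun i : Fin m => (i : ℕ) < Module.finrank ℝ (toLin X).range := by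
    ext i
    simp [posIdx, σ, (toLin X).singularValues_pos_iff_lt_finrank_range]
  have hle : Module.finrank ℝ (toLin X).range ≤ m := by
    simpa using (toLin X).range.finrank_le
  have hcard : (posIdx X).card = Module.finrank ℝ (toLin X).range := by
    rw [hset, Fin.card_filter_val_lt, min_eq_right hle]
  rw [hcard, hset]
  simp

theorem mem_zeroIdx_iff {X : RMat m n} {i : Fin m} : i ∈ zeroIdx X ↔ i ∉ posIdx X := by
  have := σ_nonneg X i
  simp only [zeroIdx, posIdx, Finset.mem_filter, Finset.mem_univ, true_and, not_lt]
  exact ⟨fun h => h.le, fun h => le_antisymm h this⟩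

theorem mem_zeroIdx_iff_card_le {X : RMat m n} {i : Fin m} :
    i ∈ zeroIdx X ↔ (posIdx X).card ≤ (i : ℕ) := by
  rw [mem_zeroIdx_iff, mem_posIdx_iff_lt_card, not_lt]

theorem σ_eq_zero_of_card_le {X : RMat m n} {i : Fin m} (h : (posIdx X).card ≤ (i : ℕ)) :
    σ X i = 0 := by
  have := mem_zeroIdx_iff_card_le.2 h
  simpa [zeroIdx] using this

theorem posIdx_ssubset_iff {X X' : RMat m n} :
    posIdx X' ⊂ posIdx X ↔ (posIdx X').card < (posIdx X).card := by
  refine ⟨Finset.card_lt_card, fun h => Finset.ssubset_iff_subset_ne.2 ⟨fun i hi => ?_, ?_⟩⟩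
  · rw [mem_posIdx_iff_lt_card] at hi ⊢
    omega
  · intro he
    rw [he] at h
    omega

theorem entry_eq_coe (v : Fin m → ℝ) (i : Fin m) : entry v ((i : ℕ) + 1) = (v i : EReal) := by
  have h : 0 < (i : ℕ) + 1 ∧ (i : ℕ) + 1 ≤ m := by omega
  simp [entry, h.2]

theorem entry_eq_coe_or_eq_top (v : Fin m → ℝ) (r : ℕ) :
    (∃ i : Fin m, (i : ℕ) + 1 = r ∧ entry v r = (v i : EReal)) ∨ entry v r = ⊤ := by
  by_cases h : 0 < r ∧ r ≤ m
  · have hr : r - 1 + 1 = r := by omega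
    refine Or.inl ⟨⟨r - 1, by omega⟩, hr, ?_⟩
    simp [entry, h]
  · right
    simp [entry, h]

theorem trim_le (μ : ℝ) (τ₁ τ₂ : EReal) (e : ℝ) : trim μ τ₁ τ₂ e ≤ e := by
  unfold trim
  split_ifs
  exacts [le_rfl, min_le_left _ _]

theorem trim_mono (μ : ℝ) (τ₁ τ₂ : EReal) : Monotone (trim μ τ₁ τ₂) := by
  intro a b hab
  unfold trim
  split_ifs
  exacts [hab, min_le_min_right _ hab]

theorem trim_entry_pos {μ : ℝ} (hμ : 0 < μ) {v : Fin m → ℝ} {r : ℕ}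
    (hv : ∀ i : Fin m, (i : ℕ) + 1 = r → 0 < v i) (τ₂ : EReal) {e : ℝ} (he : 0 < e) :
    0 < trim μ (entry v r) τ₂ e := by
  unfold trim
  split_ifs with h
  · exact he
  · rcases entry_eq_coe_or_eq_top v r with ⟨i, hi, h1⟩ | h1
    · rw [h1, EReal.toReal_coe]
      exact lt_min he (mul_pos hμ (hv i hi))
    · exact absurd (h1 ▸ le_top) h

/-- After trimming, the first zero index does not exceed the last positive one: this is what the
threshold `τ₁` is for. -/
theorem trim_entry_le {μ : ℝ} (hμ : μ ≤ 1) {v ε : Fin m → ℝ} {i j : Fin m} (hv : 0 ≤ v i) {r : ℕ}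
    (hi : (i : ℕ) + 1 = r) (hj : (j : ℕ) = r) :
    trim μ (entry v r) (entry ε (r + 1)) (ε j) ≤ v i := by
  unfold trim
  rw [← hj, entry_eq_coe ε j, hj, ← hi, entry_eq_coe v i]
  split_ifs with h
  · exact EReal.coe_le_coe_iff.1 h
  · rw [EReal.toReal_coe]
    exact (min_le_right _ _).trans (mul_le_of_le_one_left hv hμ)

theorem cap_coe (a e : ℝ) : cap (a : EReal) e = min e a := by
  unfold cap
  rcases le_total e a with h | h
  · rw [min_eq_left h, min_eq_left (EReal.coe_le_coe_iff.2 h), EReal.toReal_coe]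
  · rw [min_eq_right h, min_eq_right (EReal.coe_le_coe_iff.2 h), EReal.toReal_coe]

theorem cap_top (e : ℝ) : cap ⊤ e = e := by
  simp [cap]

theorem cap_entry_le (v : Fin m → ℝ) (r : ℕ) (e : ℝ) : cap (entry v r) e ≤ e := by
  rcases entry_eq_coe_or_eq_top v r with ⟨i, -, h⟩ | h <;> rw [h]
  · rw [cap_coe]; exact min_le_left _ _
  · rw [cap_top]

theorem cap_entry_mono (v : Fin m → ℝ) (r : ℕ) : Monotone (cap (entry v r)) := by
  intro a b hab
  rcases entry_eq_coe_or_eq_top v r with ⟨i, -, h⟩ | h <;> rw [h]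
  · rw [cap_coe, cap_coe]; exact min_le_min_right _ hab
  · rwa [cap_top, cap_top]

theorem cap_entry_pos {v : Fin m → ℝ} {r : ℕ} (hv : ∀ i : Fin m, (i : ℕ) + 1 = r → 0 < v i) {e : ℝ}
    (he : 0 < e) : 0 < cap (entry v r) e := by
  rcases entry_eq_coe_or_eq_top v r with ⟨i, hi, h⟩ | h <;> rw [h]
  · rw [cap_coe]; exact lt_min he (hv i hi)
  · rwa [cap_top]

theorem cap_entry_le_entry (v : Fin m → ℝ) {r : ℕ} {i : Fin m} (hi : (i : ℕ) + 1 = r) (e : ℝ) :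
    cap (entry v r) e ≤ v i := by
  rw [← hi, entry_eq_coe, cap_coe]
  exact min_le_right _ _

/-- The order of the perturbations that every update preserves. It makes `σ_i(X) + ε_i`
non-increasing in `i`, that is, the weights non-decreasing. -/
structure IsOrdered (X : RMat m n) (ε : Fin m → ℝ) : Prop where
  pos : ∀ i, 0 < ε i
  antitone_pos : ∀ i j : Fin m, i ≤ j → (j : ℕ) < (posIdx X).card → ε j ≤ ε i
  antitone_zero : ∀ i j : Fin m, i ≤ j → (posIdx X).card ≤ (i : ℕ) → ε j ≤ ε i
  gap : ∀ i j : Fin m, (i : ℕ) + 1 = (posIdx X).card → (j : ℕ) = (posIdx X).card →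
    ε j ≤ σ X i + ε i

theorem IsOrdered.of_antitone {X : RMat m n} {ε : Fin m → ℝ} (hpos : ∀ i, 0 < ε i)
    (hε : Antitone ε) : IsOrdered X ε where
  pos := hpos
  antitone_pos _ _ h _ := hε h
  antitone_zero _ _ h _ := hε h
  gap i j hi hj := by
    have hij : i ≤ j := by
      rw [Fin.le_def]
      omega
    linarith [hε hij, σ_nonneg X i]

theorem IsOrdered.antitone_add {X : RMat m n} {ε : Fin m → ℝ} (h : IsOrdered X ε) :
    Antitone fun i => σ X i + ε i := by
  intro i j hij
  have hσ := σ_antitone X hij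
  have hij' : (i : ℕ) ≤ j := hij
  dsimp only
  by_cases hj : (j : ℕ) < (posIdx X).card
  · linarith [h.antitone_pos i j hij hj]
  by_cases hi : (posIdx X).card ≤ (i : ℕ)
  · linarith [h.antitone_zero i j hij hi]
  -- `i` is a positive and `j` a zero index: pass through the two indices at the rank of `X`.
  have hr : (posIdx X).card - 1 + 1 = (posIdx X).card := by omega
  have hlt : (posIdx X).card < m := by omega
  have h1 := h.gap ⟨(posIdx X).card - 1, by omega⟩ ⟨(posIdx X).card, hlt⟩ hr rfl
  have h2 := h.antitone_zero ⟨(posIdx X).card, hlt⟩ j (Fin.le_def.2 (not_lt.1 hj)) le_rfl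
  have hle : i ≤ (⟨(posIdx X).card - 1, by omega⟩ : Fin m) :=
    Fin.le_def.2 (Nat.le_sub_one_of_lt (not_le.1 hi))
  have h3 := h.antitone_pos i ⟨(posIdx X).card - 1, by omega⟩ hle
    (show (posIdx X).card - 1 < (posIdx X).card by omega)
  have h4 := σ_antitone X hle
  rw [σ_eq_zero_of_card_le (not_lt.1 hj)]
  linarith

/-- The `IsOrdered` fields follow from monotonicity of the update on each side of the rank, and from
`trim_entry_le` across it. -/
theorem updateSame_spec {μ : ℝ} (hμ : μ ∈ Set.Ioo (0 : ℝ) 1) {X X' : RMat m n} {ε : Fin m → ℝ}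
    (h : IsOrdered X ε) (hr : (posIdx X').card = (posIdx X).card) :
    IsOrdered X' (updateSame μ X' ε) ∧ (∀ i, updateSame μ X' ε i ≤ ε i) ∧
      ∀ i ∈ posIdx X', updateSame μ X' ε i ≤ μ * ε i := by
  obtain ⟨hμ0, hμ1⟩ := hμ
  unfold updateSame
  simp only [mem_posIdx_iff_lt_card, mem_zeroIdx_iff_card_le]
  set ε₁ : Fin m → ℝ := fun i => if (i : ℕ) < (posIdx X').card then μ * ε i else ε i with hε₁
  have hε₁pos : ∀ i, 0 < ε₁ i := by
    intro i
    have := h.pos i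
    simp only [hε₁]
    split_ifs <;> positivity
  have hvpos : ∀ i, 0 < σ X' i + ε₁ i := fun i => add_pos_of_nonneg_of_pos (σ_nonneg _ _) (hε₁pos i)
  have hgap := fun i j => @trim_entry_le m μ hμ1.le (fun i => σ X' i + ε₁ i) ε i j (hvpos i).le
    (posIdx X').card
  have hTpos := fun e => @trim_entry_pos m μ hμ0 (fun i => σ X' i + ε₁ i) (posIdx X').card
    (fun i _ => hvpos i) (entry ε ((posIdx X').card + 1)) e
  have hTle := trim_le μ (entry (fun i => σ X' i + ε₁ i) (posIdx X').card)
    (entry ε ((posIdx X').card + 1))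
  have hTmono := trim_mono μ (entry (fun i => σ X' i + ε₁ i) (posIdx X').card)
    (entry ε ((posIdx X').card + 1))
  generalize trim μ (entry (fun i => σ X' i + ε₁ i) (posIdx X').card)
    (entry ε ((posIdx X').card + 1)) = T at *
  have hμε : ∀ i, μ * ε i ≤ ε i := fun i => mul_le_of_le_one_left (h.pos i).le hμ1.le
  refine ⟨⟨?_, ?_, ?_, ?_⟩, ?_, ?_⟩
  · intro i
    rcases le_or_gt (posIdx X').card (i : ℕ) with h1 | h1
    · rw [if_pos h1]; exact hTpos _ (h.pos i)
    · rw [if_neg (not_le.2 h1)]; exact hε₁pos i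
  · intro i j hij hj
    have hij' : (i : ℕ) ≤ j := hij
    simp only [if_neg (not_le.2 hj), if_pos hj,
      if_neg (show ¬ (posIdx X').card ≤ (i : ℕ) by omega),
      if_pos (show (i : ℕ) < (posIdx X').card by omega)]
    exact mul_le_mul_of_nonneg_left (h.antitone_pos i j hij (hr ▸ hj)) hμ0.le
  · intro i j hij hi
    have hij' : (i : ℕ) ≤ j := hij
    simp only [if_pos hi, if_pos (hi.trans hij')]
    exact hTmono (h.antitone_zero i j hij (hr ▸ hi))
  · intro i j hi hj
    simp only [if_pos hj.ge, if_neg (show ¬ (posIdx X').card ≤ (i : ℕ) by omega)]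
    exact hgap i j hi hj
  · intro i
    rcases le_or_gt (posIdx X').card (i : ℕ) with h1 | h1
    · rw [if_pos h1]; exact hTle _
    · simp only [if_neg (not_le.2 h1), if_pos h1, hμε]
  · intro i hi
    simp only [if_neg (not_le.2 hi), if_pos hi, le_refl]

theorem updateShrink_spec {μ : ℝ} (hμ : μ ∈ Set.Ioo (0 : ℝ) 1) {X X' : RMat m n} {ε : Fin m → ℝ}
    (h : IsOrdered X ε) (hr : (posIdx X').card < (posIdx X).card) :
    IsOrdered X' (updateShrink μ X X' ε) ∧ (∀ i, updateShrink μ X X' ε i ≤ ε i) ∧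
      ∀ i ∈ posIdx X', updateShrink μ X X' ε i ≤ μ * ε i := by
  obtain ⟨hμ0, hμ1⟩ := hμ
  unfold updateShrink
  simp only [mem_posIdx_iff_lt_card, mem_zeroIdx_iff_card_le, Finset.mem_sdiff]
  set ε₁ : Fin m → ℝ := fun i => if (i : ℕ) < (posIdx X').card then μ * ε i else ε i with hε₁
  have hε₁pos : ∀ i, 0 < ε₁ i := by
    intro i
    have := h.pos i
    simp only [hε₁]
    split_ifs <;> positivity
  have hvpos : ∀ i, 0 < σ X' i + ε₁ i := fun i => add_pos_of_nonneg_of_pos (σ_nonneg _ _) (hε₁pos i)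
  have hgap := fun i j => @trim_entry_le m μ hμ1.le (fun i => σ X' i + ε₁ i) ε i j (hvpos i).le
    (posIdx X').card
  have hTpos := fun e => @trim_entry_pos m μ hμ0 (fun i => σ X' i + ε₁ i) (posIdx X').card
    (fun i _ => hvpos i) (entry ε ((posIdx X').card + 1)) e
  have hTle := trim_le μ (entry (fun i => σ X' i + ε₁ i) (posIdx X').card)
    (entry ε ((posIdx X').card + 1))
  have hTmono := trim_mono μ (entry (fun i => σ X' i + ε₁ i) (posIdx X').card)
    (entry ε ((posIdx X').card + 1))
  generalize trim μ (entry (fun i => σ X' i + ε₁ i) (posIdx X').card)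
    (entry ε ((posIdx X').card + 1)) = T at *
  set ε₂ : Fin m → ℝ := fun i =>
    if (i : ℕ) < (posIdx X).card ∧ ¬ (i : ℕ) < (posIdx X').card then T (ε i) else ε₁ i with hε₂
  have hε₂pos : ∀ i, 0 < ε₂ i := by
    intro i
    simp only [hε₂]
    split_ifs
    exacts [hTpos _ (h.pos i), hε₁pos i]
  have hKpos := fun e => @cap_entry_pos m ε₂ (posIdx X).card (fun i _ => hε₂pos i) e
  have hKle := cap_entry_le ε₂ (posIdx X).card
  have hKmono := cap_entry_mono ε₂ (posIdx X).card
  have hKgap := fun i => @cap_entry_le_entry m ε₂ (posIdx X).card i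
  generalize cap (entry ε₂ (posIdx X).card) = K at *
  have hμε : ∀ i, μ * ε i ≤ ε i := fun i => mul_le_of_le_one_left (h.pos i).le hμ1.le
  have hlow : ∀ i : Fin m, (i : ℕ) < (posIdx X').card →
      (if (posIdx X).card ≤ (i : ℕ) then K (ε i) else ε₂ i) = μ * ε i := by
    intro i hi
    simp only [hε₂, hε₁, if_neg (show ¬ (posIdx X).card ≤ (i : ℕ) by omega), hi, not_true,
      and_false, if_false, if_true]
  have hmid : ∀ i : Fin m, (posIdx X').card ≤ (i : ℕ) → (i : ℕ) < (posIdx X).card →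
      (if (posIdx X).card ≤ (i : ℕ) then K (ε i) else ε₂ i) = T (ε i) := by
    intro i hi hi'
    simp only [hε₂, if_neg (not_le.2 hi'), hi', not_lt.2 hi, not_false_iff, and_true, if_true]
  have hhigh : ∀ i : Fin m, (posIdx X).card ≤ (i : ℕ) →
      (if (posIdx X).card ≤ (i : ℕ) then K (ε i) else ε₂ i) = K (ε i) := fun i hi => if_pos hi
  refine ⟨⟨?_, ?_, ?_, ?_⟩, ?_, ?_⟩
  · intro i
    rcases le_or_gt (posIdx X).card (i : ℕ) with h1 | h1
    · rw [if_pos h1]; exact hKpos _ (h.pos i)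
    · rw [if_neg (not_le.2 h1)]; exact hε₂pos i
  · intro i j hij hj
    have hij' : (i : ℕ) ≤ j := hij
    rw [hlow j hj, hlow i (by omega)]
    exact mul_le_mul_of_nonneg_left (h.antitone_pos i j hij (by omega)) hμ0.le
  · intro i j hij hi
    have hij' : (i : ℕ) ≤ j := hij
    by_cases hj : (j : ℕ) < (posIdx X).card
    · rw [hmid j (by omega) hj, hmid i hi (by omega)]
      exact hTmono (h.antitone_pos i j hij hj)
    rw [hhigh j (by omega)]
    by_cases hi' : (i : ℕ) < (posIdx X).card
    · -- the cap is the last of the trimmed entries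
      rw [hmid i hi hi']
      have hl : (posIdx X).card - 1 + 1 = (posIdx X).card := by omega
      refine (hKgap ⟨(posIdx X).card - 1, by omega⟩ hl _).trans ?_
      have hl2 := hmid ⟨(posIdx X).card - 1, by omega⟩ 
        (show (posIdx X').card ≤ (posIdx X).card - 1 by omega)
        (show (posIdx X).card - 1 < (posIdx X).card by omega)
      rw [if_neg (show ¬ (posIdx X).card ≤ (posIdx X).card - 1 by omega)] at hl2
      rw [hl2]
      exact hTmono (h.antitone_pos i _ (Fin.le_def.2 (show (i : ℕ) ≤ (posIdx X).card - 1 by omega))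
        (show (posIdx X).card - 1 < (posIdx X).card by omega))
    · rw [hhigh i (by omega)]
      exact hKmono (h.antitone_zero i j hij (by omega))
  · intro i j hi hj
    rw [hlow i (by omega), hmid j hj.ge (by omega)]
    have := hgap i j hi hj
    simpa only [hε₁, if_pos (show (i : ℕ) < (posIdx X').card by omega)] using this
  · intro i
    by_cases h1 : (posIdx X).card ≤ (i : ℕ)
    · rw [hhigh i h1]; exact hKle _
    by_cases h2 : (posIdx X').card ≤ (i : ℕ)
    · rw [hmid i h2 (by omega)]; exact hTle _
    · rw [hlow i (by omega)]; exact hμε i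
  · intro i hi
    rw [hlow i hi]

theorem updateGrow_spec {μ : ℝ} (hμ : μ ∈ Set.Ioo (0 : ℝ) 1) {X X' : RMat m n} {ε : Fin m → ℝ}
    (h : IsOrdered X ε) (hr : (posIdx X).card < (posIdx X').card) :
    IsOrdered X' (updateGrow μ X X' ε) ∧ (∀ i, updateGrow μ X X' ε i ≤ ε i) ∧
      ∀ i ∈ posIdx X', updateGrow μ X X' ε i ≤ μ * ε i := by
  obtain ⟨hμ0, hμ1⟩ := hμ
  unfold updateGrow
  simp only [mem_posIdx_iff_lt_card, mem_zeroIdx_iff_card_le, Finset.mem_sdiff]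
  set ε₁ : Fin m → ℝ := fun i => if (i : ℕ) < (posIdx X).card then μ * ε i else ε i with hε₁
  have hKpos := fun e => @cap_entry_pos m ε (posIdx X).card (fun i _ => h.pos i) e
  have hKle := cap_entry_le ε (posIdx X).card
  have hKmono := cap_entry_mono ε (posIdx X).card
  have hKgap := fun i => @cap_entry_le_entry m ε (posIdx X).card i
  generalize cap (entry ε (posIdx X).card) = K at *
  set ε₂ : Fin m → ℝ := fun i =>
    if (i : ℕ) < (posIdx X').card ∧ ¬ (i : ℕ) < (posIdx X).card then μ * K (ε i) else ε₁ i with hε₂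
  have hε₂pos : ∀ i, 0 < ε₂ i := by
    intro i
    have h1 := h.pos i
    have h2 := hKpos _ h1
    simp only [hε₂, hε₁]
    split_ifs <;> positivity
  have hvpos : ∀ i, 0 < σ X' i + ε₂ i := fun i => add_pos_of_nonneg_of_pos (σ_nonneg _ _) (hε₂pos i)
  have hgap := fun i j => @trim_entry_le m μ hμ1.le (fun i => σ X' i + ε₂ i) ε i j (hvpos i).le
    (posIdx X').card
  have hTpos := fun e => @trim_entry_pos m μ hμ0 (fun i => σ X' i + ε₂ i) (posIdx X').card
    (fun i _ => hvpos i) (entry ε ((posIdx X').card + 1)) e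
  have hTle := trim_le μ (entry (fun i => σ X' i + ε₂ i) (posIdx X').card)
    (entry ε ((posIdx X').card + 1))
  have hTmono := trim_mono μ (entry (fun i => σ X' i + ε₂ i) (posIdx X').card)
    (entry ε ((posIdx X').card + 1))
  generalize trim μ (entry (fun i => σ X' i + ε₂ i) (posIdx X').card)
    (entry ε ((posIdx X').card + 1)) = T at *
  have hμε : ∀ i, μ * ε i ≤ ε i := fun i => mul_le_of_le_one_left (h.pos i).le hμ1.le
  have hlow : ∀ i : Fin m, (i : ℕ) < (posIdx X).card →
      (if (posIdx X').card ≤ (i : ℕ) then T (ε i) else ε₂ i) = μ * ε i := by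
    intro i hi
    simp only [hε₂, hε₁, if_neg (show ¬ (posIdx X').card ≤ (i : ℕ) by omega), hi, not_true,
      and_false, if_false, if_true]
  have hmid : ∀ i : Fin m, (posIdx X).card ≤ (i : ℕ) → (i : ℕ) < (posIdx X').card →
      (if (posIdx X').card ≤ (i : ℕ) then T (ε i) else ε₂ i) = μ * K (ε i) := by
    intro i hi hi'
    simp only [hε₂, if_neg (not_le.2 hi'), hi', not_lt.2 hi, not_false_iff, and_true, if_true]
  have hhigh : ∀ i : Fin m, (posIdx X').card ≤ (i : ℕ) →
      (if (posIdx X').card ≤ (i : ℕ) then T (ε i) else ε₂ i) = T (ε i) := fun i hi => if_pos hi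
  have hpos : ∀ i : Fin m, (i : ℕ) < (posIdx X').card →
      (if (posIdx X').card ≤ (i : ℕ) then T (ε i) else ε₂ i) ≤ μ * ε i := by
    intro i hi
    by_cases h2 : (posIdx X).card ≤ (i : ℕ)
    · rw [hmid i h2 hi]
      exact mul_le_mul_of_nonneg_left (hKle _) hμ0.le
    · rw [hlow i (by omega)]
  refine ⟨⟨?_, ?_, ?_, ?_⟩, ?_, hpos⟩
  · intro i
    rcases le_or_gt (posIdx X').card (i : ℕ) with h1 | h1
    · rw [if_pos h1]; exact hTpos _ (h.pos i)
    · rw [if_neg (not_le.2 h1)]; exact hε₂pos i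
  · intro i j hij hj
    have hij' : (i : ℕ) ≤ j := hij
    by_cases hj' : (j : ℕ) < (posIdx X).card
    · rw [hlow j hj', hlow i (by omega)]
      exact mul_le_mul_of_nonneg_left (h.antitone_pos i j hij hj') hμ0.le
    rw [hmid j (by omega) hj]
    by_cases hi : (i : ℕ) < (posIdx X).card
    · -- the cap is the last perturbation at a positive index of `X`
      rw [hlow i hi]
      have hl : (posIdx X).card - 1 + 1 = (posIdx X).card := by omega
      refine mul_le_mul_of_nonneg_left
        ((hKgap ⟨(posIdx X).card - 1, by omega⟩ hl _).trans ?_) hμ0.le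
      exact h.antitone_pos i _ (Fin.le_def.2 (show (i : ℕ) ≤ (posIdx X).card - 1 by omega))
        (show (posIdx X).card - 1 < (posIdx X).card by omega)
    · rw [hmid i (by omega) (by omega)]
      exact mul_le_mul_of_nonneg_left (hKmono (h.antitone_zero i j hij (by omega))) hμ0.le
  · intro i j hij hi
    have hij' : (i : ℕ) ≤ j := hij
    rw [hhigh j (by omega), hhigh i hi]
    exact hTmono (h.antitone_zero i j hij (by omega))
  · intro i j hi hj
    rw [hhigh j hj.ge, if_neg (by omega)]
    exact hgap i j hi hj
  · intro i
    by_cases h1 : (posIdx X').card ≤ (i : ℕ)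
    · rw [hhigh i h1]; exact hTle _
    · exact (hpos i (by omega)).trans (hμε i)

/-- An update preserves the order of the perturbations, increases none of them, and shrinks those
at the positive singular values of the new iterate by the factor `μ`. -/
theorem updateEps_spec {μ : ℝ} (hμ : μ ∈ Set.Ioo (0 : ℝ) 1) {X X' : RMat m n} {ε : Fin m → ℝ}
    (h : IsOrdered X ε) :
    IsOrdered X' (updateEps μ X X' ε) ∧ (∀ i, updateEps μ X X' ε i ≤ ε i) ∧
      ∀ i ∈ posIdx X', updateEps μ X X' ε i ≤ μ * ε i := by
  unfold updateEps
  split_ifs with h1 h2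
  · exact updateShrink_spec hμ h (posIdx_ssubset_iff.1 h1)
  · exact updateGrow_spec hμ h (posIdx_ssubset_iff.1 h2)
  · rw [posIdx_ssubset_iff] at h1 h2
    exact updateSame_spec hμ h (by omega)

end EIRNRI

/-! ### First-order bounds for functions with Lipschitz gradient and for convex functions -/

section Gradient

open scoped Gradient

variable {E : Type*} [NormedAddCommGroup E] [InnerProductSpace ℝ E] [CompleteSpace E] {f : E → ℝ}

theorem hasDerivAt_comp_add_smul (hf : Differentiable ℝ f) (x d : E) (t : ℝ) :
    HasDerivAt (fun t : ℝ => f (x + t • d)) (inner ℝ (∇ f (x + t • d)) d) t := by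
  have h1 := (hf (x + t • d)).hasGradientAt.hasFDerivAt
  have h2 : HasDerivAt (fun t : ℝ => x + t • d) d t := by
    simpa using ((hasDerivAt_id t).smul_const d).const_add x
  exact (h1.comp_hasDerivAt t h2).congr_deriv (by simp)

/-- The descent lemma, in its two-sided form. -/
theorem abs_sub_sub_inner_gradient_le (hf : Differentiable ℝ f) {L : ℝ}
    (hL : ∀ x y, ‖∇ f x - ∇ f y‖ ≤ L * ‖x - y‖) (x y : E) :
    |f y - f x - inner ℝ (∇ f x) (y - x)| ≤ L / 2 * ‖y - x‖ ^ 2 := by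
  set d := y - x with hd
  have hg : ∀ t : ℝ, HasDerivAt (fun t : ℝ => f (x + t • d) - f x - t * inner ℝ (∇ f x) d)
      (inner ℝ (∇ f (x + t • d) - ∇ f x) d) t := by
    intro t
    rw [inner_sub_left]
    exact (((hasDerivAt_comp_add_smul hf x d t).sub_const (f x)).sub
      ((hasDerivAt_id t).mul_const (inner ℝ (∇ f x) d))).congr_deriv (by rw [one_mul])
  have hB : ∀ t : ℝ, HasDerivAt (fun t : ℝ => L / 2 * ‖d‖ ^ 2 * t ^ 2) (L * ‖d‖ ^ 2 * t) t := by
    intro t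
    have := ((hasDerivAt_pow 2 t).const_mul (L / 2 * ‖d‖ ^ 2))
    exact this.congr_deriv (by push_cast; ring)
  have h := image_norm_le_of_norm_deriv_right_le_deriv_boundary (a := 0) (b := 1)
    (fun t _ => (hg t).continuousAt.continuousWithinAt) (fun t _ => (hg t).hasDerivWithinAt)
    (B := fun t : ℝ => L / 2 * ‖d‖ ^ 2 * t ^ 2) (by simp) hB (fun t ht => by
      calc ‖inner ℝ (∇ f (x + t • d) - ∇ f x) d‖
          ≤ ‖∇ f (x + t • d) - ∇ f x‖ * ‖d‖ := norm_inner_le_norm _ _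
        _ ≤ L * ‖x + t • d - x‖ * ‖d‖ := by gcongr; exact hL _ _
        _ = L * ‖d‖ ^ 2 * t := by
          rw [add_sub_cancel_left, norm_smul, Real.norm_eq_abs, abs_of_nonneg ht.1]; ring)
    (Set.right_mem_Icc.2 zero_le_one)
  simpa [hd] using h

theorem ConvexOn.add_inner_gradient_le (hc : ConvexOn ℝ Set.univ f) (hf : Differentiable ℝ f)
    (x y : E) : f x + inner ℝ (∇ f x) (y - x) ≤ f y := by
  have hline : ConvexOn ℝ Set.univ fun t : ℝ => f (x + t • (y - x)) := by
    have := hc.comp_affineMap (AffineMap.lineMap x y)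
    simpa [Function.comp_def, AffineMap.lineMap_apply, add_comm] using this
  have h := hline.le_slope_of_hasDerivAt (Set.mem_univ 0) (Set.mem_univ 1) zero_lt_one
    (hasDerivAt_comp_add_smul hf x (y - x) 0)
  simp only [slope_def_field, zero_smul, one_smul, add_zero, add_sub_cancel, sub_zero, div_one] at h
  linarith

end Gradient

/-- Tangent inequality for the concave power `t ↦ t ^ p`. -/
theorem Real.rpow_le_rpow_add_mul_sub {p a b : ℝ} (hp0 : 0 ≤ p) (hp1 : p ≤ 1) (ha : 0 < a)
    (hb : 0 ≤ b) : b ^ p ≤ a ^ p + p * a ^ (p - 1) * (b - a) := by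
  have h := rpow_one_add_le_one_add_mul_self (s := b / a - 1)
    (by have := div_nonneg hb ha.le; linarith) hp0 hp1
  rw [add_sub_cancel, Real.div_rpow hb ha.le, div_le_iff₀ (Real.rpow_pos_of_pos ha p)] at h
  refine h.trans_eq ?_
  rw [Real.rpow_sub_one ha.ne']
  field_simp

namespace EIRNRI

open scoped Gradient

variable {m n : ℕ}

/-! ### The weights -/

theorem weight_le_weight {p : ℝ} (hp : p ∈ Set.Ioo (0 : ℝ) 1) {s e s' e' : ℝ} (h0 : 0 < s' + e')
    (h : s' + e' ≤ s + e) : weight p s e ≤ weight p s' e' :=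
  mul_le_mul_of_nonneg_left (Real.rpow_le_rpow_of_nonpos h0 h (by linarith [hp.2])) hp.1.le

theorem weight_pos {p : ℝ} (hp : 0 < p) {s e : ℝ} (h0 : 0 < s + e) : 0 < weight p s e :=
  mul_pos hp (Real.rpow_pos_of_pos h0 _)

/-- The weight drops to `D` exactly when `s + e` reaches the threshold `(p / D)^(1 / (1 - p))`. -/
theorem weight_le_iff {p : ℝ} (hp : p ∈ Set.Ioo (0 : ℝ) 1) {s e D : ℝ} (h0 : 0 < s + e)
    (hD : 0 < D) : weight p s e ≤ D ↔ (p / D) ^ (1 / (1 - p)) ≤ s + e := by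
  have hp1 : 0 < 1 - p := by linarith [hp.2]
  rw [one_div, Real.rpow_inv_le_iff_of_pos (div_pos hp.1 hD).le h0.le hp1, weight,
    show p - 1 = -(1 - p) by ring, Real.rpow_neg h0.le, ← div_eq_mul_inv,
    div_le_comm₀ (Real.rpow_pos_of_pos h0 _) hD]

theorem le_weight_iff {p : ℝ} (hp : p ∈ Set.Ioo (0 : ℝ) 1) {s e D : ℝ} (h0 : 0 < s + e)
    (hD : 0 < D) : D ≤ weight p s e ↔ s + e ≤ (p / D) ^ (1 / (1 - p)) := by
  have hp1 : 0 < 1 - p := by linarith [hp.2]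
  rw [one_div, Real.le_rpow_inv_iff_of_pos h0.le (div_pos hp.1 hD).le hp1, weight,
    show p - 1 = -(1 - p) by ring, Real.rpow_neg h0.le, ← div_eq_mul_inv,
    le_div_comm₀ hD (Real.rpow_pos_of_pos h0 _)]

theorem mul_div_eq_div_div {lam p β c : ℝ} (hβ : 0 < β) (hlam : 0 < lam) (hc : 0 < c) :
    lam * p / (2 * β * c) = p / (2 * β * c / lam) := by
  field_simp

/-! ### The subproblem -/

/-- Completing the square, the surrogate is a weighted nuclear norm proximal problem. -/
theorem surrogate_eq (f : RMat m n → ℝ) {lam p β : ℝ} (hβ : β ≠ 0) (Xk Yk : RMat m n)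
    (ε : Fin m → ℝ) :
    ∃ a : ℝ, ∀ Z, surrogate f lam p β Xk Yk ε Z = a
      + (β * ‖Z - ((1 / 2 : ℝ) • (Xk + Yk) - (1 / (2 * β)) • ∇ f Yk)‖ ^ 2
      + lam * ∑ i, weight p (σ Xk i) (ε i) * σ Z i) := by
  refine ⟨f Yk + β / 2 * ‖Yk‖ ^ 2 + β / 2 * ‖Xk‖ ^ 2
    - β * ‖(1 / 2 : ℝ) • (Xk + Yk) - (1 / (2 * β)) • ∇ f Yk‖ ^ 2, fun Z => ?_⟩
  rw [surrogate, norm_sub_sq_real Z, norm_sub_sq_real Z, norm_sub_sq_real Z, inner_sub_right,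
    inner_smul_right, inner_smul_right, inner_add_right]
  field_simp
  ring

namespace IsRun

variable {f : RMat m n → ℝ} {lam p β μ αbar : ℝ} {X : ℕ → RMat m n} {ε : ℕ → Fin m → ℝ}
  {α : ℕ → ℝ}

theorem isOrdered (h : IsRun f lam p β μ αbar X ε α) (hμ : μ ∈ Set.Ioo (0 : ℝ) 1) (k : ℕ) :
    IsOrdered (X k) (ε k) := by
  induction k with
  | zero => exact IsOrdered.of_antitone h.eps_zero_pos h.eps_zero_antitone
  | succ k ih =>
    rw [h.eps_succ]
    exact (updateEps_spec hμ ih).1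

theorem eps_succ_le (h : IsRun f lam p β μ αbar X ε α) (hμ : μ ∈ Set.Ioo (0 : ℝ) 1) (k : ℕ)
    (i : Fin m) : ε (k + 1) i ≤ ε k i := by
  rw [h.eps_succ]
  exact (updateEps_spec hμ (h.isOrdered hμ k)).2.1 i

theorem eps_succ_le_mul (h : IsRun f lam p β μ αbar X ε α) (hμ : μ ∈ Set.Ioo (0 : ℝ) 1) (k : ℕ)
    {i : Fin m} (hi : 0 < σ (X (k + 1)) i) : ε (k + 1) i ≤ μ * ε k i := by
  rw [h.eps_succ]
  exact (updateEps_spec hμ (h.isOrdered hμ k)).2.2 i (by simpa [posIdx] using hi)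

theorem add_eps_pos (h : IsRun f lam p β μ αbar X ε α) (hμ : μ ∈ Set.Ioo (0 : ℝ) 1) (k : ℕ)
    (i : Fin m) : 0 < σ (X k) i + ε k i :=
  add_pos_of_nonneg_of_pos (σ_nonneg _ _) ((h.isOrdered hμ k).pos i)

/-- The shrinkage inequality for an iterate: the weights are non-decreasing by `IsOrdered`. -/
theorem σ_succ_add_le (h : IsRun f lam p β μ αbar X ε α) (hμ : μ ∈ Set.Ioo (0 : ℝ) 1)
    (hp : p ∈ Set.Ioo (0 : ℝ) 1) (hβ : 0 < β) (hlam : 0 < lam) {C₁ : ℝ}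
    (hC : IsCenterBound f β X α C₁) (k : ℕ) {i : Fin m} (hi : 0 < σ (X (k + 1)) i) :
    σ (X (k + 1)) i + lam * weight p (σ (X k) i) (ε k i) / (2 * β) ≤ C₁ := by
  obtain ⟨a, ha⟩ := surrogate_eq f (lam := lam) (p := p) hβ.ne' (X k) (extrap X α k) (ε k)
  refine σ_add_le_of_isMinOn hβ hlam (C := proxCenter f β X α k)
    (w := fun i => weight p (σ (X k) i) (ε k i)) ?_ ?_ (hC.2 k) hi
  · intro i j hij
    exact weight_le_weight hp (h.add_eps_pos hμ k j) ((h.isOrdered hμ k).antitone_add hij)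
  · intro Z
    have := h.iterate_mem_argmin k (Set.mem_univ Z)
    simp only [Set.mem_ofPred_eq, ha] at this
    exact le_of_add_le_add_left this

/-! ### Boundedness of the iterates -/

/-- The potential `f(X^k) + lam ∑ (σ_i(X^k) + ε_i^k)^p + β/2 ‖X^k - X^(k-1)‖²` does not increase:
the surrogate majorizes the smoothed objective, and the error `‖X^k - Y^k‖ = α_k ‖X^k - X^(k-1)‖`
of the extrapolation is paid for by the last term of the potential. -/
theorem potential_succ_le (h : IsRun f lam p β μ αbar X ε α) (hμ : μ ∈ Set.Ioo (0 : ℝ) 1)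
    (hp : p ∈ Set.Ioo (0 : ℝ) 1) (hlam : 0 < lam) {L : ℝ} (hβ : L ≤ β) (hf : LSmooth L f)
    {c : ℝ} (hc0 : 0 ≤ c + β / 2)
    (hc : ∀ x y, f y + inner ℝ (∇ f y) (x - y) - c * ‖x - y‖ ^ 2 ≤ f x)
    (hcα : (c + β / 2) * αbar ^ 2 ≤ β / 2) (k : ℕ) :
    f (X (k + 1)) + lam * ∑ i, (σ (X (k + 1)) i + ε (k + 1) i) ^ p
        + β / 2 * ‖X (k + 1) - X k‖ ^ 2
      ≤ f (X k) + lam * ∑ i, (σ (X k) i + ε k i) ^ p + β / 2 * ‖X k - X (k - 1)‖ ^ 2 := by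
  set Y := extrap X α k with hY
  have hmin := h.iterate_mem_argmin k (Set.mem_univ (X k))
  simp only [Set.mem_ofPred_eq, surrogate, sub_self, norm_zero, ← hY] at hmin
  have hup := (abs_le.1 (abs_sub_sub_inner_gradient_le hf.1 hf.2 Y (X (k + 1)))).2
  have hlow := hc (X k) Y
  have hsum : ∑ i, (σ (X (k + 1)) i + ε (k + 1) i) ^ p
      ≤ ∑ i, (σ (X k) i + ε k i) ^ p
        + (∑ i, weight p (σ (X k) i) (ε k i) * σ (X (k + 1)) i
          - ∑ i, weight p (σ (X k) i) (ε k i) * σ (X k) i) := by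
    rw [← Finset.sum_sub_distrib, ← Finset.sum_add_distrib]
    refine Finset.sum_le_sum fun i _ => ?_
    have h1 := h.add_eps_pos hμ k i
    have h2 := h.add_eps_pos hμ (k + 1) i
    have h3 := h.eps_succ_le hμ k i
    have h4 := Real.rpow_le_rpow_add_mul_sub hp.1.le hp.2.le h1 h2.le
    refine h4.trans ?_
    have hw := weight_pos hp.1 h1
    rw [weight] at hw ⊢
    nlinarith
  have hsum' := mul_le_mul_of_nonneg_left hsum hlam.le
  have hYX : ‖X k - Y‖ ^ 2 ≤ αbar ^ 2 * ‖X k - X (k - 1)‖ ^ 2 := by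
    have : X k - Y = -(α k • (X k - X (k - 1))) := by rw [hY, extrap]; abel
    rw [this, norm_neg, norm_smul, mul_pow, Real.norm_eq_abs, sq_abs]
    exact mul_le_mul_of_nonneg_right (pow_le_pow_left₀ (h.alpha_mem k).1 (h.alpha_mem k).2 2)
      (sq_nonneg _)
  have h5 : (c + β / 2) * ‖X k - Y‖ ^ 2 ≤ β / 2 * ‖X k - X (k - 1)‖ ^ 2 := by
    calc _ ≤ (c + β / 2) * (αbar ^ 2 * ‖X k - X (k - 1)‖ ^ 2) :=
          mul_le_mul_of_nonneg_left hYX hc0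
      _ = ((c + β / 2) * αbar ^ 2) * ‖X k - X (k - 1)‖ ^ 2 := by ring
      _ ≤ _ := mul_le_mul_of_nonneg_right hcα (sq_nonneg _)
  have h6 : L / 2 * ‖X (k + 1) - Y‖ ^ 2 ≤ β / 2 * ‖X (k + 1) - Y‖ ^ 2 :=
    mul_le_mul_of_nonneg_right (by linarith) (sq_nonneg _)
  simp only [inner_sub_right] at hup hlow
  rw [real_inner_comm (∇ f Y) (X k), real_inner_comm (∇ f Y) (X (k + 1))] at *
  linarith

end IsRun

/-- Both kinds of extrapolation bounds allow a quadratic lower model of `f` whose error is paid for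
by the proximal term: with curvature `0` if `f` is convex, with curvature `L` in general. -/
theorem AdmissibleBound.exists_curvature {f : RMat m n → ℝ} {L β αbar : ℝ} (hL : 0 ≤ L)
    (hβ : L < β) (hf : LSmooth L f) (hα : AdmissibleBound f L β αbar) :
    ∃ c : ℝ, 0 ≤ c ∧ (∀ x y, f y + inner ℝ (∇ f y) (x - y) - c * ‖x - y‖ ^ 2 ≤ f x) ∧
      (c + β / 2) * αbar ^ 2 ≤ β / 2 := by
  obtain ⟨hα0, ⟨hconv, hα1⟩ | hα1⟩ := hα
  · refine ⟨0, le_rfl, fun x y => ?_, ?_⟩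
    · simpa using hconv.add_inner_gradient_le hf.1 y x
    · have : αbar ^ 2 ≤ 1 := pow_le_one₀ hα0.le hα1.le
      nlinarith
  · refine ⟨L / 2, by positivity, fun x y => ?_, ?_⟩
    · linarith [(abs_le.1 (abs_sub_sub_inner_gradient_le hf.1 hf.2 y x)).1]
    · have h1 : αbar ^ 2 < β / (β + 3 * L) := (Real.lt_sqrt hα0.le).1 hα1
      rw [lt_div_iff₀ (by linarith)] at h1
      nlinarith [sq_nonneg αbar]

theorem IsRun.exists_norm_le {f : RMat m n → ℝ} {L lam p β μ αbar : ℝ} {X : ℕ → RMat m n}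
    {ε : ℕ → Fin m → ℝ} {α : ℕ → ℝ} (h : IsRun f lam p β μ αbar X ε α)
    (hμ : μ ∈ Set.Ioo (0 : ℝ) 1) (hp : p ∈ Set.Ioo (0 : ℝ) 1) (hlam : 0 < lam) (hL : 0 ≤ L)
    (hβ : L < β) (hf : LSmooth L f) (hF : LevelBounded (objective f lam p))
    (hα : AdmissibleBound f L β αbar) : ∃ R, ∀ k, ‖X k‖ ≤ R := by
  obtain ⟨c, hc0, hc, hcα⟩ := hα.exists_curvature hL hβ hf
  set H : ℕ → ℝ := fun k =>
    f (X k) + lam * ∑ i, (σ (X k) i + ε k i) ^ p + β / 2 * ‖X k - X (k - 1)‖ ^ 2 with hH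
  have hanti : Antitone H := antitone_nat_of_succ_le fun k =>
    h.potential_succ_le hμ hp hlam hβ.le hf (by linarith) hc hcα k
  obtain ⟨R, hR⟩ := (hF (H 0)).exists_norm_le
  refine ⟨R, fun k => hR _ ?_⟩
  refine le_trans ?_ (hanti (Nat.zero_le k))
  have hsum : ∑ i, σ (X k) i ^ p ≤ ∑ i, (σ (X k) i + ε k i) ^ p :=
    Finset.sum_le_sum fun i _ => Real.rpow_le_rpow (σ_nonneg _ _)
      (by linarith [(h.isOrdered hμ k).pos i]) hp.1.le
  have h1 := mul_le_mul_of_nonneg_left hsum hlam.le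
  have h2 : 0 ≤ β / 2 * ‖X k - X (k - 1)‖ ^ 2 := mul_nonneg (by linarith) (sq_nonneg _)
  simp only [objective, hH]
  linarith

theorem IsRun.exists_isCenterBound {f : RMat m n → ℝ} {L lam p β μ αbar : ℝ} (hmn : m ≤ n)
    {X : ℕ → RMat m n} {ε : ℕ → Fin m → ℝ} {α : ℕ → ℝ} (h : IsRun f lam p β μ αbar X ε α)
    (hμ : μ ∈ Set.Ioo (0 : ℝ) 1) (hp : p ∈ Set.Ioo (0 : ℝ) 1) (hlam : 0 < lam) (hL : 0 ≤ L)
    (hβ : L < β) (hf : LSmooth L f) (hF : LevelBounded (objective f lam p))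
    (hα : AdmissibleBound f L β αbar) : ∃ C₁, IsCenterBound f β X α C₁ := by
  obtain ⟨R, hR⟩ := h.exists_norm_le hμ hp hlam hL hβ hf hF hα
  have hR0 : 0 ≤ R := (norm_nonneg _).trans (hR 0)
  have hα0 := hα.1
  have hY : ∀ k, ‖extrap X α k‖ ≤ R + αbar * (R + R) := by
    intro k
    refine (norm_add_le _ _).trans (add_le_add (hR k) ?_)
    rw [norm_smul, Real.norm_eq_abs, abs_of_nonneg (h.alpha_mem k).1]
    exact mul_le_mul (h.alpha_mem k).2 ((norm_sub_le _ _).trans (add_le_add (hR _) (hR _)))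
      (norm_nonneg _) hα0.le
  have hG : ∀ k, ‖∇ f (extrap X α k)‖ ≤ ‖∇ f 0‖ + L * (R + αbar * (R + R)) := by
    intro k
    have h1 := hf.2 (extrap X α k) 0
    rw [sub_zero] at h1
    have h2 := norm_le_norm_add_norm_sub' (∇ f (extrap X α k)) (∇ f 0)
    have h3 := mul_le_mul_of_nonneg_left (hY k) hL
    linarith
  have hβ0 : 0 < 1 / (2 * β) := by
    have : 0 < β := by linarith
    positivity
  refine ⟨1 / 2 * (R + (R + αbar * (R + R)))
    + 1 / (2 * β) * (‖∇ f 0‖ + L * (R + αbar * (R + R))) + 1, by positivity, fun k i => ?_⟩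
  refine (σ_le_norm hmn _ i).trans ?_
  refine (norm_sub_le _ _).trans ?_
  rw [norm_smul, norm_smul, Real.norm_of_nonneg hβ0.le, Real.norm_of_nonneg (by norm_num)]
  have h1 := mul_le_mul_of_nonneg_left
    ((norm_add_le _ _).trans (add_le_add (hR k) (hY k))) (show (0 : ℝ) ≤ 1 / 2 by norm_num)
  have h2 := mul_le_mul_of_nonneg_left (hG k) hβ0.le
  linarith

end EIRNRI

namespace EIRNRI

/-! ### Identification of the rank -/

namespace IsRun

open Filter Topology

variable {m n : ℕ} {f : RMat m n → ℝ} {lam p β μ αbar : ℝ} {X : ℕ → RMat m n}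
  {ε : ℕ → Fin m → ℝ} {α : ℕ → ℝ} {C₁ : ℝ}

/-- An index with a large weight gives a zero singular value at the next iterate, and there the
weight is at least as large, since the perturbation does not increase. -/
theorem σ_eq_zero_of_lt_weight (h : IsRun f lam p β μ αbar X ε α) (hμ : μ ∈ Set.Ioo (0 : ℝ) 1)
    (hp : p ∈ Set.Ioo (0 : ℝ) 1) (hβ : 0 < β) (hlam : 0 < lam)
    (hC : IsCenterBound f β X α C₁) {k₀ : ℕ} {i : Fin m}
    (hw : 2 * β * C₁ / lam < weight p (σ (X k₀) i) (ε k₀ i)) {k : ℕ} (hk : k₀ < k) :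
    σ (X k) i = 0 := by
  have hstep : ∀ k, 2 * β * C₁ / lam < weight p (σ (X k) i) (ε k i) →
      σ (X (k + 1)) i = 0 ∧ 2 * β * C₁ / lam < weight p (σ (X (k + 1)) i) (ε (k + 1) i) := by
    intro k hk
    have h0 : σ (X (k + 1)) i = 0 := by
      by_contra hne
      have hpos := lt_of_le_of_ne (σ_nonneg (X (k + 1)) i) (Ne.symm hne)
      have h1 := h.σ_succ_add_le hμ hp hβ hlam hC k hpos
      rw [div_lt_iff₀ hlam] at hk
      have h2 : C₁ < lam * weight p (σ (X k) i) (ε k i) / (2 * β) := by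
        rw [lt_div_iff₀ (by positivity)]
        linarith
      linarith
    refine ⟨h0, hk.trans_le (weight_le_weight hp (h.add_eps_pos hμ (k + 1) i) ?_)⟩
    rw [h0]
    linarith [h.eps_succ_le hμ k i, σ_nonneg (X k) i]
  obtain ⟨j, rfl⟩ : ∃ j, k = k₀ + j + 1 := ⟨k - k₀ - 1, by omega⟩
  have hall : ∀ j, 2 * β * C₁ / lam < weight p (σ (X (k₀ + j)) i) (ε (k₀ + j) i) := by
    intro j
    induction j with
    | zero => exact hw
    | succ j ih => exact (hstep _ ih).2
  exact (hstep _ (hall j)).1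

/-- Equality in the threshold is excluded: it would leave `σ_i(X^(k+1)) ≤ C₁ - C₁ = 0`. -/
theorem lt_σ_add_eps (h : IsRun f lam p β μ αbar X ε α) (hμ : μ ∈ Set.Ioo (0 : ℝ) 1)
    (hp : p ∈ Set.Ioo (0 : ℝ) 1) (hβ : 0 < β) (hlam : 0 < lam)
    (hC : IsCenterBound f β X α C₁) {k : ℕ} {i : Fin m} (hi : 0 < σ (X (k + 1)) i) :
    (lam * p / (2 * β * C₁)) ^ (1 / (1 - p)) < σ (X k) i + ε k i := by
  have hC₁ := hC.1
  rw [mul_div_eq_div_div hβ hlam hC₁]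
  by_contra hle
  have h1 := (le_weight_iff hp (h.add_eps_pos hμ k i) (by positivity)).2 (not_lt.1 hle)
  have h2 := h.σ_succ_add_le hμ hp hβ hlam hC k hi
  have h3 : C₁ ≤ lam * weight p (σ (X k) i) (ε k i) / (2 * β) := by
    rw [div_le_iff₀ hlam] at h1
    rw [le_div_iff₀ (by positivity)]
    linarith
  linarith

/-- The non-increasing sequence `ε_i^k` is multiplied by at most `μ < 1` infinitely often. -/
theorem tendsto_eps (h : IsRun f lam p β μ αbar X ε α) (hμ : μ ∈ Set.Ioo (0 : ℝ) 1) {i : Fin m}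
    (hi : ∃ᶠ k in atTop, 0 < σ (X k) i) : Tendsto (fun k => ε k i) atTop (𝓝 0) := by
  have hpos : ∀ k, 0 < ε k i := fun k => (h.isOrdered hμ k).pos i
  have hanti : Antitone fun k => ε k i := antitone_nat_of_succ_le fun k => h.eps_succ_le hμ k i
  have hlim := tendsto_atTop_ciInf hanti ⟨0, by rintro _ ⟨k, rfl⟩; exact (hpos k).le⟩
  set l := ⨅ k, ε k i
  have hl0 : 0 ≤ l := ge_of_tendsto' hlim fun k => (hpos k).le
  have hle : ∀ k, l ≤ ε k i := fun k => hanti.le_of_tendsto hlim k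
  have hfreq : ∃ᶠ k in atTop, l ≤ μ * ε k i := by
    rw [frequently_atTop] at hi ⊢
    intro N
    obtain ⟨k, hk, hσ⟩ := hi (N + 1)
    obtain ⟨j, rfl⟩ : ∃ j, k = j + 1 := ⟨k - 1, by omega⟩
    exact ⟨j, by omega, (hle _).trans (h.eps_succ_le_mul hμ j hσ)⟩
  have hlμ : l ≤ μ * l := ge_of_tendsto_of_frequently (hlim.const_mul μ) hfreq
  have : l = 0 := by nlinarith [hμ.2]
  rwa [this] at hlim

theorem eventually_σ_pos (h : IsRun f lam p β μ αbar X ε α) (hμ : μ ∈ Set.Ioo (0 : ℝ) 1)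
    (hp : p ∈ Set.Ioo (0 : ℝ) 1) (hβ : 0 < β) (hlam : 0 < lam)
    (hC : IsCenterBound f β X α C₁) {i : Fin m} (hi : ∃ᶠ k in atTop, 0 < σ (X k) i) :
    ∀ᶠ k in atTop, 0 < σ (X k) i := by
  have hC₁ := hC.1
  have hD : 0 < 2 * β * C₁ / lam := by positivity
  have hT : 0 < (p / (2 * β * C₁ / lam)) ^ (1 / (1 - p)) := Real.rpow_pos_of_pos (div_pos hp.1 hD) _
  filter_upwards [(h.tendsto_eps hμ hi).eventually_lt_const hT] with k hk
  by_contra hσ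
  have h0 : σ (X k) i = 0 := le_antisymm (not_lt.1 hσ) (σ_nonneg _ _)
  -- A zero singular value with a small perturbation has a weight beyond the threshold.
  have hw : 2 * β * C₁ / lam < weight p (σ (X k) i) (ε k i) := by
    by_contra hle
    have := (weight_le_iff hp (h.add_eps_pos hμ k i) hD).1 (not_lt.1 hle)
    linarith
  obtain ⟨j, hj, hjσ⟩ := frequently_atTop.1 hi (k + 1)
  exact hjσ.ne' (h.σ_eq_zero_of_lt_weight hμ hp hβ hlam hC hw (by omega))

/-- The strict lower bound for the limits. A singular value `σ_i(X^k)` close to the threshold has a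
weight close to `2βC₁/lam`, which pushes `σ_i(X^(k+1))` close to `0`, below the threshold. Hence the
weights stay away from `2βC₁/lam`, and the singular values away from the threshold. -/
theorem lt_liminf_σ (h : IsRun f lam p β μ αbar X ε α) (hμ : μ ∈ Set.Ioo (0 : ℝ) 1)
    (hp : p ∈ Set.Ioo (0 : ℝ) 1) (hβ : 0 < β) (hlam : 0 < lam)
    (hC : IsCenterBound f β X α C₁) {i : Fin m} (hi : ∃ᶠ k in atTop, 0 < σ (X k) i) :
    (lam * p / (2 * β * C₁)) ^ (1 / (1 - p)) < liminf (fun k => σ (X k) i) atTop := by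
  have hp1 : 0 < 1 - p := by linarith [hp.2]
  have hC₁ := hC.1
  have hev := h.eventually_σ_pos hμ hp hβ hlam hC hi
  have hev' := (tendsto_add_atTop_nat 1).eventually hev
  have hev'' := (tendsto_add_atTop_nat 2).eventually hev
  have hε := h.tendsto_eps hμ hi
  have hε' := hε.comp (tendsto_add_atTop_nat 1)
  set T := (lam * p / (2 * β * C₁)) ^ (1 / (1 - p)) with hT
  have hT0 : 0 < T := Real.rpow_pos_of_pos (div_pos (mul_pos hlam hp.1) (by positivity)) _
  have hweight : ∀ᶠ k in atTop,
      weight p (σ (X k) i) (ε k i) ≤ 2 * β * (C₁ - T / 2) / lam := by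
    filter_upwards [hev', hev'', hε'.eventually_lt_const (half_pos hT0)] with k h1 h2 h3
    have h4 := h.lt_σ_add_eps hμ hp hβ hlam hC h2
    have h5 := h.σ_succ_add_le hμ hp hβ hlam hC k h1
    simp only [Function.comp_apply] at h3
    have h6 : lam * weight p (σ (X k) i) (ε k i) / (2 * β) ≤ C₁ - T / 2 := by linarith
    rw [div_le_iff₀ (by positivity)] at h6
    rw [le_div_iff₀ hlam]
    linarith
  -- `C₁ - T / 2` is positive because it bounds positive weights.
  have hD' : 0 < 2 * β * (C₁ - T / 2) / lam := by
    obtain ⟨k, hk⟩ := hweight.exists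
    exact (weight_pos hp.1 (h.add_eps_pos hμ k i)).trans_le hk
  set T' := (p / (2 * β * (C₁ - T / 2) / lam)) ^ (1 / (1 - p)) with hT'
  have hTT' : T < T' := by
    rw [hT, hT', mul_div_eq_div_div hβ hlam hC₁]
    have hD : 0 < 2 * β * C₁ / lam := by positivity
    refine Real.rpow_lt_rpow (div_pos hp.1 hD).le ?_ (by positivity)
    refine div_lt_div_of_pos_left hp.1 hD' (div_lt_div_of_pos_right ?_ hlam)
    exact mul_lt_mul_of_pos_left (by linarith) (by positivity)
  have hlow : ∀ᶠ k in atTop, (T + T') / 2 ≤ σ (X k) i := by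
    filter_upwards [hweight, hε.eventually_lt_const (half_pos (sub_pos.2 hTT'))] with k h1 h2
    have h3 := (weight_le_iff hp (h.add_eps_pos hμ k i) hD').1 h1
    linarith
  have hup : ∀ᶠ k in atTop, σ (X k) i ≤ C₁ := by
    filter_upwards [hev, eventually_ge_atTop 1] with k h1 hk
    obtain ⟨j, rfl⟩ : ∃ j, k = j + 1 := ⟨k - 1, by omega⟩
    have h2 := h.σ_succ_add_le hμ hp hβ hlam hC j h1
    have h3 := weight_pos hp.1 (h.add_eps_pos hμ j i)
    have h4 : 0 ≤ lam * weight p (σ (X j) i) (ε j i) / (2 * β) := by positivity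
    linarith
  calc T < (T + T') / 2 := by linarith
    _ ≤ _ := le_liminf_of_le
      (IsBoundedUnder.isCoboundedUnder_ge ⟨C₁, eventually_map.2 hup⟩) hlow

end IsRun

end EIRNRI

theorem mainTheorem2 {m n : ℕ} (hmn : m ≤ n) (f : EIRNRI.RMat m n → ℝ)
    (L lam p β μ αbar : ℝ)
    (hp : p ∈ Set.Ioo (0 : ℝ) 1) (hlam : 0 < lam) (hμ : μ ∈ Set.Ioo (0 : ℝ) 1)
    (hL : 0 ≤ L) (hβ : L < β)
    (hf : EIRNRI.LSmooth L f)
    (hF : EIRNRI.LevelBounded (EIRNRI.objective f lam p))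
    (hα : EIRNRI.AdmissibleBound f L β αbar)
    (X : ℕ → EIRNRI.RMat m n) (ε : ℕ → Fin m → ℝ) (α : ℕ → ℝ)
    (hrun : EIRNRI.IsRun f lam p β μ αbar X ε α) :
    (∃ C₁ : ℝ, EIRNRI.IsCenterBound f β X α C₁) ∧
    ∀ C₁ : ℝ, EIRNRI.IsCenterBound f β X α C₁ →
      (∀ (k₀ : ℕ) (i : Fin m),
        2 * β * C₁ / lam < EIRNRI.weight p (EIRNRI.σ (X k₀) i) (ε k₀ i) →
          ∀ k, k₀ < k → EIRNRI.σ (X k) i = 0) ∧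
      ∃ (k₁ : ℕ) (Istar Zstar : Finset (Fin m)),
        (∀ k, k₁ < k → EIRNRI.posIdx (X k) = Istar ∧ EIRNRI.zeroIdx (X k) = Zstar) ∧
        (∀ k, k₁ < k → ∀ i ∈ EIRNRI.posIdx (X k),
          (lam * p / (2 * β * C₁)) ^ (1 / (1 - p)) - ε k i < EIRNRI.σ (X k) i ∧
          0 < (lam * p / (2 * β * C₁)) ^ (1 / (1 - p)) - ε k i) ∧
        (∀ i ∈ Istar,
          (lam * p / (2 * β * C₁)) ^ (1 / (1 - p)) <
            Filter.liminf (fun k => EIRNRI.σ (X k) i) Filter.atTop) := by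
  classical
  have hβ0 : 0 < β := hL.trans_lt hβ
  refine ⟨hrun.exists_isCenterBound hmn hμ hp hlam hL hβ hf hF hα, fun C₁ hC => ?_⟩
  have hC₁ := hC.1
  refine ⟨fun k₀ i hw k hk => hrun.σ_eq_zero_of_lt_weight hμ hp hβ0 hlam hC hw hk, ?_⟩
  have hT0 : 0 < (lam * p / (2 * β * C₁)) ^ (1 / (1 - p)) :=
    Real.rpow_pos_of_pos (div_pos (mul_pos hlam hp.1) (by positivity)) _
  -- By the dichotomy, positive infinitely often means eventually positive.
  set Istar : Finset (Fin m) :=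
    Finset.univ.filter fun i => ∃ᶠ k in Filter.atTop, 0 < EIRNRI.σ (X k) i with hI
  have hpos : ∀ᶠ k in Filter.atTop, ∀ i, 0 < EIRNRI.σ (X k) i ↔ i ∈ Istar := by
    refine Filter.eventually_all.2 fun i => ?_
    by_cases hi : ∃ᶠ k in Filter.atTop, 0 < EIRNRI.σ (X k) i
    · filter_upwards [hrun.eventually_σ_pos hμ hp hβ0 hlam hC hi] with k hk
      simp [hI, hk, hi]
    · filter_upwards [Filter.not_frequently.1 hi] with k hk
      simp only [hI, Finset.mem_filter, Finset.mem_univ, true_and, hk, hi]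
  have heps : ∀ᶠ k in Filter.atTop, ∀ i, i ∈ Istar →
      ε k i < (lam * p / (2 * β * C₁)) ^ (1 / (1 - p)) := by
    refine Filter.eventually_all.2 fun i => ?_
    by_cases hi : ∃ᶠ k in Filter.atTop, 0 < EIRNRI.σ (X k) i
    · filter_upwards [(hrun.tendsto_eps hμ hi).eventually_lt_const hT0] with k hk _ using hk
    · exact Filter.Eventually.of_forall fun k hk => absurd (by simpa [hI] using hk) hi
  obtain ⟨k₁, hk₁⟩ := Filter.eventually_atTop.1 (hpos.and heps)
  have hset : ∀ k, k₁ < k → EIRNRI.posIdx (X k) = Istar := by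
    intro k hk
    ext i
    simpa [EIRNRI.posIdx] using (hk₁ k hk.le).1 i
  refine ⟨k₁, Istar, Istarᶜ, fun k hk => ⟨hset k hk, ?_⟩, fun k hk i hi => ?_, fun i hi => ?_⟩
  · ext i
    rw [EIRNRI.mem_zeroIdx_iff, hset k hk, Finset.mem_compl]
  · rw [hset k hk] at hi
    have h1 := hrun.lt_σ_add_eps hμ hp hβ0 hlam hC (((hk₁ (k + 1) (by omega)).1 i).2 hi)
    have h2 := (hk₁ k hk.le).2 i hi
    exact ⟨by linarith, by linarith⟩
  · exact hrun.lt_liminf_σ hμ hp hβ0 hlam hC (by simpa [hI] using hi)
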